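/- Let $L$ be an oriented link with planar diagram $D$, with set of crossings $\mathcal X$, of which $n_+$ are positive and $n_-$ negative. For a vertex $I\colon\mathcal X\to\{0,1\}$ of the hypercube of resolutions let $D(I)$ be the collection of circles obtained by resolving each crossing $x$ according to $I(x)$, and let $|I|=\sum_x I(x)$. The edges $e\colon I\to J$ of the hypercube change one resolution from $0$ to $1$; each is a one-handle cobordism $D(I)\to D(J)$, a merge or a split of circles. *Even complex.* Khovanov's $sl(2)$ complex $\mathrm{CKh}(D)$ is $\bigoplus_I A^{\otimes\{\text{circles of }D(I)\}}$, where $A=\mathbb Z\langle v_+,v_-\rangle$ has the product $v_+v_+=v_+$, $v_+v_-=v_-v_+=v_-$, $v_-v_-=0$ and the coproduct $\Delta v_+=v_+\otimes v_-+v_-\otimes v_+$, $\Delta v_-=v_-\otimes v_-$. Its differential is the sum over the edges of the product (for a merge) or coproduct (for a split), with the usual signs $(-1)^{\#\{\text{1-resolutions at crossings before the one that changes}\}}$ for an ordering of $\mathcal X$. *Odd complex.* Choose an arrow at each crossing: on the $0$-resolution it joins the two strands, and on the $1$-resolution it is rotated by $90^\circ$ counterclockwise. Let $V(D(I))$ be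 the free abelian group on the circles of $D(I)$ and $C(D)=\bigoplus_I\Lambda^*V(D(I))$. For a merge $e\colon I\to J$ of circles $a_1,a_2$ let $F_e\colon\Lambda^*V(D(I))\to\Lambda^*V(D(J))$ be induced by $V(D(I))\to V(D(I))/(a_1-a_2)\cong V(D(J))$. For a split into circles $a_1,a_2$, with the arrow pointing from $a_1$ to $a_2$, let $F_e$ be the composite $\Lambda^*V(D(I))\cong\Lambda^*\big(V(D(J))/(a_1-a_2)\big)\cong(a_1-a_2)\wedge\Lambda^*V(D(J))\subset\Lambda^*V(D(J))$, where the second isomorphism is left multiplication by $a_1-a_2$ of any lift. The two composites around a square face of the hypercube are nonzero and anticommute (type A), nonzero and commute (type C), or are both zero. In the last case the arcs of the two crossings lie on different sides of one circle and their feet alternate on it. Walk along this circle from the tail of the first arrow with the first arc on the left: the face is of type X if the tail of the second arrow comes before the head of the first arrow, and of type Y if the head of the second arrow does. Let $\epsilon\colon\{\text{edges}\}\to\{\pm1\}$ be an edge assignment of type X (the product of the four signs is $+1$ on faces of types A and X, and $-1$ on faces of types C and Y) or of type Y (the product is $+1$ on faces of types A and Y, and $-1$ on faces of types C and X), and put $\partial_\epsilon=\sum_e\epsilon(e)F_e$.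 *Gradings.* Both groups are bigraded by $m=|I|-n_-$ and $s=Q_0+n_+-2n_-+|I|$, where $Q_0=\operatorname{rank}V(D(I))-2r$ on $\Lambda^rV(D(I))$, and $Q_0$ is the number of factors $v_+$ minus the number of factors $v_-$ on a tensor product of basis elements of $A$. **Proposition 1.5.** For every such $D$, choice of arrows, and edge assignment $\epsilon$ of type X or Y, $(\mathrm{CKh}(D),d)$ and $(C(D),\partial_\epsilon)$ are bigraded complexes, with differentials that raise $m$ by one and preserve $s$, and their reductions modulo two are isomorphic as bigraded complexes: $$\mathrm{CKh}(D)\otimes\mathbb Z/2\;\cong\;C(D)\otimes\mathbb Z/2 .$$ Consequently, writing $\mathrm{Kh}_{m,s}(L)$ and $\mathrm{Kh}'_{m,s}(L)$ for the homology groups in bidegree $(m,s)$ of these two complexes (the even and the odd Khovanov homology of $L$), for all $m,s\in\mathbb Z$ $$\mathrm{Tor}(\mathrm{Kh}_{m+1,s}(L),\mathbb Z/2)\oplus\big(\mathrm{Kh}_{m,s}(L)\otimes\mathbb Z/2\big)\;\cong\;\mathrm{Tor}(\mathrm{Kh}'_{m+1,s}(L),\mathbb Z/2)\oplus\big(\mathrm{Kh}'_{m,s}(L)\otimes\mathbb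 Z/2\big).$$ -/

import Mathlib

open scoped DirectSum TensorProduct

noncomputable section

namespace OddKhovanov

/-! ### Oriented link diagrams -/

/-- The four ends of the `n` crossings of a diagram. The ends of a crossing are numbered
`0, 1, 2, 3` counterclockwise, `0` being the incoming end of the lower strand; so the lower strand
runs from `0` to `2` and the upper strand joins `1` and `3`. -/
abbrev Dart (n : ℕ) : Type := Fin n × Fin 4

/-- The next end, counterclockwise, at the same crossing. -/
def rotate {n : ℕ} (d : Dart n) : Dart n := (d.1, d.2 + 1)

/-- Given the signs of the crossings, whether the strand through an end is oriented away from the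
crossing there. The lower strand leaves through `2`; the upper strand runs from `3` to `1` at a
positive crossing and from `1` to `3` at a negative one. -/
def IsOutgoing {n : ℕ} (positive : Fin n → Bool) (d : Dart n) : Prop :=
  d.2 = 2 ∨ (d.2 = 1 ∧ positive d.1 = true) ∨ (d.2 = 3 ∧ positive d.1 = false)

/-- An oriented link diagram, as a planar diagram code: a 4-valent plane graph, given by its
rotation system, with over/under information at the vertices and a compatible orientation, together
with a number of further components that meet no crossing. -/
structure LinkDiagram where
  /-- the number of crossings -/
  n : ℕ
  /-- the number of components (circles) without crossings -/
  loops : ℕ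
  /-- the sign of each crossing -/
  positive : Fin n → Bool
  /-- the other end of the edge of the diagram that starts at a given end of a crossing -/
  opp : Dart n → Dart n
  opp_opp : ∀ d, opp (opp d) = d
  /-- each edge leaves one crossing and enters one -/
  oriented : ∀ d, IsOutgoing positive (opp d) ↔ ¬ IsOutgoing positive d
  /-- Planarity of the rotation system, by Euler's formula: the graph has `n` vertices and `2 n`
  edges, and `V - E + F` is twice its number of connected components. -/
  planar : (n : ℤ) - 2 * n + Nat.card (Quot fun d e : Dart n => e = rotate (opp d)) =
    2 * Nat.card (Quot fun d e : Dart n => e = opp d ∨ e = rotate d)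

namespace LinkDiagram

variable (D : LinkDiagram)

/-- The number of positive crossings. -/
def nPlus : ℕ := (Finset.univ.filter fun c => D.positive c = true).card

/-- The number of negative crossings. -/
def nMinus : ℕ := (Finset.univ.filter fun c => D.positive c = false).card

/-! ### The hypercube of resolutions -/

/-- A vertex of the hypercube: `true` stands for the 1-resolution, `false` for the
0-resolution. -/
abbrev Vertex : Type := Fin D.n → Bool

/-- The end to which a given end of a crossing is joined by the resolution: the 0-resolution joins
`0` with `1` and `2` with `3`, the 1-resolution joins `0` with `3` and `1` with `2`. -/
def smooth (I : D.Vertex) (d : Dart D.n) : Dart D.n :=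
  (d.1, if I d.1 = true then ![3, 2, 1, 0] d.2 else ![1, 0, 3, 2] d.2)

/-- The components (circles) of the resolution `D(I)`. -/
abbrev Circle (I : D.Vertex) : Type :=
  (Quot fun d e : Dart D.n => e = D.opp d ∨ e = D.smooth I d) ⊕ Fin D.loops

instance (I : D.Vertex) : Fintype (D.Circle I) := Fintype.ofFinite _

/-- The circle of `D(I)` through a given end of a crossing. -/
def circ (I : D.Vertex) (d : Dart D.n) : D.Circle I := Sum.inl (Quot.mk _ d)

/-- An edge of the hypercube: the resolution of one crossing changes from 0 to 1. -/
abbrev Edge : Type := {p : D.Vertex × Fin D.n // p.1 p.2 = false}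

variable {D}

def Edge.src (e : D.Edge) : D.Vertex := e.1.1

def Edge.crossing (e : D.Edge) : Fin D.n := e.1.2

def Edge.tgt (e : D.Edge) : D.Vertex := Function.update e.src e.crossing true

variable (D)

/-- The number of crossings with the 1-resolution. -/
def height (I : D.Vertex) : ℕ := (Finset.univ.filter fun c => I c = true).card

/-! ### The odd complex -/

/-- `V(D(I))`, the free abelian group on the circles of `D(I)`. -/
abbrev V (I : D.Vertex) : Type := D.Circle I →₀ ℤ

/-- `Λ^* V(D(I))`. -/
abbrev Lam (I : D.Vertex) : Type := ExteriorAlgebra ℤ (D.V I)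

/-- `C(D)`, the sum of the `Λ^* V(D(I))` over the vertices of the hypercube. -/
abbrev OddChain : Type := ⨁ I : D.Vertex, D.Lam I

/-- An orientation of the crossings, that is a choice of arrow at each of them: `true` means that
the arrow on the 0-resolution points from the strand joining the ends `0, 1` to the strand joining
the ends `2, 3`; `false` means the opposite arrow. -/
abbrev Arrows : Type := Fin D.n → Bool

/-- A circle of `D(J)` that shares an end of a crossing with the given circle of `D(I)`
(and the same circle, if it meets no crossing). -/
def carry (I J : D.Vertex) : D.Circle I → D.Circle J :=
  Sum.elim (fun q => D.circ J q.out) Sum.inr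

/-- If `D(J)` is obtained from `D(I)` by merging circles, this is the map induced by the
projection of `V(D(I))` to its quotient `V(D(J))`. If `D(J)` is obtained by splitting a
circle `a` into `a₁` and `a₂`, it lifts the elements of `Λ^* V(D(I))`, where
`V(D(I)) = V(D(J)) / (a₁ - a₂)`, to `Λ^* V(D(J))`; the lift depends on choices
only up to the ideal generated by `a₁ - a₂`. -/
def carryMap (I J : D.Vertex) : D.Lam I →ₗ[ℤ] D.Lam J :=
  (ExteriorAlgebra.map (Finsupp.lmapDomain ℤ ℤ (D.carry I J))).toLinearMap

/-- The element `a₁ - a₂` for a split at the crossing `c` with result `D(J)`. The arrow on the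
1-resolution, which is the arrow on the 0-resolution rotated by 90 degrees counterclockwise, points
from `a₁` to `a₂`. -/
def splitElt (o : D.Arrows) (J : D.Vertex) (c : Fin D.n) : D.V J :=
  let v := Finsupp.single (D.circ J (c, 1)) (1 : ℤ) - Finsupp.single (D.circ J (c, 3)) 1
  if o c = true then v else -v

open Classical in
/-- The map `Λ^* V(D(I)) → Λ^* V(D(J))` of the one-handle at the crossing `c`, where `J` is `I` with
the resolution at `c` changed from 0 to 1: the projection if the two feet of the handle lie
on different circles (a merge), and lifting followed by wedge product with `a₁ - a₂` if
they lie on the same circle (a split). -/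
def oddMap (o : D.Arrows) (I J : D.Vertex) (c : Fin D.n) : D.Lam I →ₗ[ℤ] D.Lam J :=
  if D.circ I (c, 0) = D.circ I (c, 2) then
    LinearMap.mulLeft ℤ (ExteriorAlgebra.ι ℤ (D.splitElt o J c)) ∘ₗ D.carryMap I J
  else D.carryMap I J

/-- A square face of the hypercube: at two crossings `x₁ ≠ x₂` the resolution changes
from 0 to 1. -/
structure Face where
  src : D.Vertex
  x₁ : Fin D.n
  x₂ : Fin D.n
  ne : x₁ ≠ x₂
  h₁ : src x₁ = false
  h₂ : src x₂ = false

namespace Face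

variable {D} (f : D.Face)

/-- The corner of the face at which only the resolution at `x₁` has changed. -/
def mid₁ : D.Vertex := Function.update f.src f.x₁ true

/-- The corner of the face at which only the resolution at `x₂` has changed. -/
def mid₂ : D.Vertex := Function.update f.src f.x₂ true

/-- The last corner of the face. -/
def last : D.Vertex := Function.update f.mid₁ f.x₂ true

/-- The two edges that leave the first corner, then the two edges that enter the last one. -/
def e₁ : D.Edge := ⟨(f.src, f.x₁), f.h₁⟩

def e₂ : D.Edge := ⟨(f.src, f.x₂), f.h₂⟩

def e₁' : D.Edge :=
  ⟨(f.mid₂, f.x₁), by simpa [mid₂, Function.update_of_ne f.ne] using f.h₁⟩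

def e₂' : D.Edge :=
  ⟨(f.mid₁, f.x₂), by simpa [mid₁, Function.update_of_ne f.ne.symm] using f.h₂⟩

/-- `F_{x₂} ∘ F_{x₁}`. -/
def comp₁₂ (o : D.Arrows) : D.Lam f.src →ₗ[ℤ] D.Lam f.last :=
  D.oddMap o f.mid₁ f.last f.x₂ ∘ₗ D.oddMap o f.src f.mid₁ f.x₁

/-- `F_{x₁} ∘ F_{x₂}`. -/
def comp₂₁ (o : D.Arrows) : D.Lam f.src →ₗ[ℤ] D.Lam f.last :=
  D.oddMap o f.mid₂ f.last f.x₁ ∘ₗ D.oddMap o f.src f.mid₂ f.x₂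

/-- Type A: the double composites are nontrivial and anticommute. -/
def IsTypeA (o : D.Arrows) : Prop := f.comp₁₂ o ≠ 0 ∧ f.comp₁₂ o = -f.comp₂₁ o

/-- Type C: the double composites are nontrivial and commute. -/
def IsTypeC (o : D.Arrows) : Prop := f.comp₁₂ o ≠ 0 ∧ f.comp₁₂ o = f.comp₂₁ o

end Face

/-- One step of the walk along a circle of `D(I)`: arriving at a crossing at the end `d`, follow
the resolution and then the next edge, and arrive at the end `D.step I d`. -/
def step (I : D.Vertex) (d : Dart D.n) : Dart D.n := D.opp (D.smooth I d)

/-- The walk along a circle of `D(I)` that arrives at `p` arrives at `q` at some later time, and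
does not arrive at `r` up to then. -/
def ReachesBefore (I : D.Vertex) (p q r : Dart D.n) : Prop :=
  ∃ k : ℕ, (D.step I)^[k] p = q ∧ ∀ j ≤ k, (D.step I)^[j] p ≠ r

/-- The ends at which a walk arrives at the tail, and at the head, of the arrow on the 0-resolution
of `c` if it passes there with the arrow on its left. -/
def tailLeft (o : D.Arrows) (c : Fin D.n) : Dart D.n := (c, if o c = true then 0 else 2)

def headLeft (o : D.Arrows) (c : Fin D.n) : Dart D.n := (c, if o c = true then 2 else 0)

/-- The same for a walk that passes there with the arrow on its right. -/
def tailRight (o : D.Arrows) (c : Fin D.n) : Dart D.n := (c, if o c = true then 1 else 3)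

def headRight (o : D.Arrows) (c : Fin D.n) : Dart D.n := (c, if o c = true then 3 else 1)

namespace Face

variable {D} (f : D.Face)

/-- The two remaining types of faces are those with trivial double composites: the two arcs lie on
different sides of a single circle, on which their feet alternate. Walk along this circle with the
first arc on the left, starting at the tail of the first arrow. In type X the tail of the
second arrow comes before the head of the first. (Exchanging the two arcs gives
the same type.) -/
def IsTypeX (o : D.Arrows) : Prop :=
  f.comp₁₂ o = 0 ∧ f.comp₂₁ o = 0 ∧
    D.ReachesBefore f.src (D.tailLeft o f.x₁) (D.tailRight o f.x₂) (D.headLeft o f.x₁)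

/-- In type Y the head of the second arrow comes before the head of the first. -/
def IsTypeY (o : D.Arrows) : Prop :=
  f.comp₁₂ o = 0 ∧ f.comp₂₁ o = 0 ∧
    D.ReachesBefore f.src (D.tailLeft o f.x₁) (D.headRight o f.x₂) (D.headLeft o f.x₁)

/-- The product of the signs of the four edges of a face. It is `1` for an even face and `-1` for
an odd one. -/
def sign (ε : D.Edge → ℤˣ) : ℤˣ := ε f.e₁ * ε f.e₂ * ε f.e₁' * ε f.e₂'

end Face

/-- Type X edge assignments: faces of types A and X are even, those of types C and Y are odd. -/
def IsTypeXAssignment (o : D.Arrows) (ε : D.Edge → ℤˣ) : Prop :=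
  ∀ f : D.Face, (f.IsTypeA o ∨ f.IsTypeX o → f.sign ε = 1) ∧
    (f.IsTypeC o ∨ f.IsTypeY o → f.sign ε = -1)

/-- Type Y edge assignments: faces of types A and Y are even, those of types C and X are odd. -/
def IsTypeYAssignment (o : D.Arrows) (ε : D.Edge → ℤˣ) : Prop :=
  ∀ f : D.Face, (f.IsTypeA o ∨ f.IsTypeY o → f.sign ε = 1) ∧
    (f.IsTypeC o ∨ f.IsTypeX o → f.sign ε = -1)

/-- The differential `∂_ε` of `C(D)`: the sum of `ε(e) F_e` over the edges of the hypercube. -/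
def oddDiff (o : D.Arrows) (ε : D.Edge → ℤˣ) : D.OddChain →ₗ[ℤ] D.OddChain :=
  ∑ e : D.Edge, ((ε e : ℤˣ) : ℤ) •
    (DirectSum.lof ℤ D.Vertex D.Lam e.tgt ∘ₗ D.oddMap o e.src e.tgt e.crossing ∘ₗ
      DirectSum.component ℤ D.Vertex D.Lam e.src)

/-- `C_{m,s}(D)`: the sum of the `Λ^r V(D(I))` of homological grading `m = M₀ - n₋` and
`q`-grading `s = Q₀ + n₊ - 2 n₋ + M₀`, where `M₀` is the number of 1-resolutions in `I` and
`Q₀ = rank V(D(I)) - 2 r`. -/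
def oddGrading (m s : ℤ) : Submodule ℤ D.OddChain :=
  ⨆ (I : D.Vertex) (r : ℕ) (_ : (D.height I : ℤ) - D.nMinus = m)
    (_ : ((Fintype.card (D.Circle I) : ℤ) - 2 * r) + D.nPlus - 2 * D.nMinus + D.height I = s),
    (⋀[ℤ]^r (D.V I)).map (DirectSum.lof ℤ D.Vertex D.Lam I)

/-! ### Khovanov's complex -/

end LinkDiagram

/-- The basis `v₊, v₋` of Khovanov's Frobenius algebra `A = ℤ[X]/(X²)`, where
`v₊ = 1` and `v₋ = X`. -/
inductive Label : Type
  | plus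
  | minus

/-- The multiplication of `A`: `m (x ⊗ y)` is the sum of the `z` with `MulRel x y z`, so
`v₊ v₊ = v₊`, `v₊ v₋ = v₋ v₊ = v₋`, `v₋ v₋ = 0`. -/
inductive MulRel : Label → Label → Label → Prop
  | pp : MulRel .plus .plus .plus
  | pm : MulRel .plus .minus .minus
  | mp : MulRel .minus .plus .minus

/-- The comultiplication of `A`: `Δ x` is the sum of the `y ⊗ z` with `ComulRel x y z`, so
`Δ v₊ = v₊ ⊗ v₋ + v₋ ⊗ v₊` and `Δ v₋ = v₋ ⊗ v₋`. -/
inductive ComulRel : Label → Label → Label → Prop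
  | ppm : ComulRel .plus .plus .minus
  | pmp : ComulRel .plus .minus .plus
  | mmm : ComulRel .minus .minus .minus

/-- The degree of a basis element of `A`. -/
def Label.deg : Label → ℤ
  | .plus => 1
  | .minus => -1

instance : Finite Label :=
  Finite.of_surjective (fun b : Bool => if b = true then Label.plus else Label.minus) fun x => by
    cases x
    · exact ⟨true, rfl⟩
    · exact ⟨false, rfl⟩

namespace LinkDiagram

variable (D : LinkDiagram)

/-- The basis of the tensor product of copies of `A` indexed by the circles of `D(I)` that consists
of the tensor products of basis elements of `A`. -/
abbrev State (I : D.Vertex) : Type := D.Circle I → Label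

/-- The basis of Khovanov's complex that is formed by the states of all resolutions. -/
abbrev EnhancedState : Type := Σ I : D.Vertex, D.State I

instance : Fintype D.EnhancedState := Fintype.ofFinite _

/-- The group underlying Khovanov's complex `CKh(D)`, the sum over the vertices `I` of the
hypercube of the tensor products of copies of `A` indexed by the circles of `D(I)`. -/
abbrev EvenChain : Type := D.EnhancedState →₀ ℤ

/-- Whether the state `τ` of `D(J)` occurs in the image of the state `σ` of `D(I)` under the map
of the one-handle at the crossing `c`, where `J` is `I` with the resolution at `c` changed
from 0 to 1. The map is the multiplication for a merge and the comultiplication for a split of the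
circles through `c`, tensored with the identity for the other circles. -/
def Occurs (I J : D.Vertex) (c : Fin D.n) (σ : D.State I) (τ : D.State J) : Prop :=
  (∀ l : Fin D.loops, τ (Sum.inr l) = σ (Sum.inr l)) ∧
  (∀ d : Dart D.n, D.circ I d ≠ D.circ I (c, 0) → D.circ I d ≠ D.circ I (c, 2) →
    τ (D.circ J d) = σ (D.circ I d)) ∧
  (D.circ I (c, 0) ≠ D.circ I (c, 2) →
    MulRel (σ (D.circ I (c, 0))) (σ (D.circ I (c, 2))) (τ (D.circ J (c, 1)))) ∧
  (D.circ I (c, 0) = D.circ I (c, 2) →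
    ComulRel (σ (D.circ I (c, 0))) (τ (D.circ J (c, 1))) (τ (D.circ J (c, 3))))

open Classical in
/-- The map of an edge of the hypercube in Khovanov's complex, extended by zero to the states of
the other vertices. -/
def evenMap (e : D.Edge) : D.EvenChain →ₗ[ℤ] D.EvenChain :=
  Finsupp.linearCombination ℤ fun S : D.EnhancedState =>
    ∑ T ∈ Finset.univ.filter (fun T : D.EnhancedState =>
        S.1 = e.src ∧ T.1 = e.tgt ∧ D.Occurs S.1 T.1 e.crossing S.2 T.2),
      Finsupp.single T (1 : ℤ)

/-- Khovanov's sign of an edge: `-1` to the number of 1-resolutions at the crossings that precede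
the crossing of the edge. -/
def evenSign (e : D.Edge) : ℤ :=
  (-1) ^ (Finset.univ.filter fun x => x < e.crossing ∧ e.src x = true).card

/-- The differential of Khovanov's complex. -/
def evenDiff : D.EvenChain →ₗ[ℤ] D.EvenChain :=
  ∑ e : D.Edge, D.evenSign e • D.evenMap e

/-- `CKh_{m,s}(D)`: the span of the states of homological grading `m = M₀ - n₋` and `q`-grading
`s = Q₀ + n₊ - 2 n₋ + M₀`, where `M₀` is the number of 1-resolutions and `Q₀` the sum of the degrees
of the labels. -/
def evenGrading (m s : ℤ) : Submodule ℤ D.EvenChain :=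
  Finsupp.supported ℤ ℤ {S : D.EnhancedState |
    (D.height S.1 : ℤ) - D.nMinus = m ∧
    (∑ a, (S.2 a).deg) + D.nPlus - 2 * D.nMinus + D.height S.1 = s}

end LinkDiagram

/-! ### Bigraded complexes and their homology -/

/-- `(M, d)`, bigraded by the subgroups `gr m s`, is a bigraded complex: `M` is the direct sum
of the `gr m s`, the map `d` raises `m` by one and preserves `s`, and `d² = 0`. -/
structure IsBigradedComplex {M : Type} [AddCommGroup M] (gr : ℤ → ℤ → Submodule ℤ M)
    (d : M →ₗ[ℤ] M) : Prop where
  internal : DirectSum.IsInternal fun p : ℤ × ℤ => gr p.1 p.2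
  map_le : ∀ m s, (gr m s).map d ≤ gr (m + 1) s
  sq_zero : d ∘ₗ d = 0

/-- The cycles of bidegree `(m, s)`. -/
def cycles {M : Type} [AddCommGroup M] (gr : ℤ → ℤ → Submodule ℤ M) (d : M →ₗ[ℤ] M)
    (m s : ℤ) : Submodule ℤ M :=
  gr m s ⊓ LinearMap.ker d

/-- The boundaries of bidegree `(m, s)`. -/
def boundaries {M : Type} [AddCommGroup M] (gr : ℤ → ℤ → Submodule ℤ M) (d : M →ₗ[ℤ] M)
    (m s : ℤ) : Submodule ℤ M :=
  (gr (m - 1) s).map d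

/-- The homology in bidegree `(m, s)`: cycles modulo boundaries. -/
abbrev Homology {M : Type} [AddCommGroup M] (gr : ℤ → ℤ → Submodule ℤ M) (d : M →ₗ[ℤ] M)
    (m s : ℤ) : Type :=
  (cycles gr d m s) ⧸ (boundaries gr d m s).submoduleOf (cycles gr d m s)

/-- The subgroup of `M ⊗ ℤ/2` of bidegree `(m, s)`: the image of `gr m s ⊗ ℤ/2`. -/
def modTwoGrading {M : Type} [AddCommGroup M] (gr : ℤ → ℤ → Submodule ℤ M) (m s : ℤ) :
    Submodule ℤ (M ⊗[ℤ] ZMod 2) :=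
  LinearMap.range (LinearMap.rTensor (ZMod 2) (gr m s).subtype)

/-- The reductions modulo two of two bigraded complexes are isomorphic as bigraded complexes. -/
def ModTwoIsomorphic {M N : Type} [AddCommGroup M] [AddCommGroup N]
    (grM : ℤ → ℤ → Submodule ℤ M) (dM : M →ₗ[ℤ] M)
    (grN : ℤ → ℤ → Submodule ℤ N) (dN : N →ₗ[ℤ] N) : Prop :=
  ∃ Φ : (M ⊗[ℤ] ZMod 2) ≃ₗ[ℤ] (N ⊗[ℤ] ZMod 2),
    (∀ x, Φ (LinearMap.rTensor (ZMod 2) dM x) = LinearMap.rTensor (ZMod 2) dN (Φ x)) ∧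
    ∀ m s, (modTwoGrading grM m s).map Φ.toLinearMap = modTwoGrading grN m s

/-- `Tor(A, ℤ/2)`, the first derived functor of the tensor product of abelian groups. -/
abbrev TorTwo (A : Type) [AddCommGroup A] : ModuleCat.{0} ℤ :=
  ((CategoryTheory.Tor (ModuleCat.{0} ℤ) 1).obj (ModuleCat.of ℤ A)).obj (ModuleCat.of ℤ (ZMod 2))

namespace LinkDiagram

variable (D : LinkDiagram)

/-- The even (ordinary) Khovanov homology `Kh_{m,s}`. -/
abbrev EvenKh (m s : ℤ) : Type := Homology D.evenGrading D.evenDiff m s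

/-- The odd Khovanov homology `Kh'_{m,s}`, computed with the arrows `o` and the edge
assignment `ε`. -/
abbrev OddKh (o : D.Arrows) (ε : D.Edge → ℤˣ) (m s : ℤ) : Type :=
  Homology D.oddGrading (D.oddDiff o ε) m s

end LinkDiagram

end OddKhovanov

end

/-! Read A^{⊗circles} as the commutative ring generated by the circles with a² = 0, where v₊ is 1
and v₋ is the variable of its circle. A merge identifies two variables; a split lifts to the new
variables and multiplies by a₁ + a₂. The odd complex is the same construction with anticommuting
variables and a₁ - a₂ in place of a₁ + a₂. Modulo two these differences and all edge signs
disappear. Hence `compare`, which sends a state to the product of its circles labelled v₋ (in some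
order), respects the bigradings and commutes with the differentials modulo two.

Both theories are handled at once. Lists of generators (ends of crossings and loops without
crossings) name products of circles in every resolution simultaneously; `IsProductFamily` and
`IsHandleMap` record how such products behave, with a parameter η that is 1 in the even and -1 in
the odd theory. By `exists_comp_eq_smul` the two composites around a square agree up to an explicit
factor. Khovanov's signs, respectively the edge assignment, then make the square of the differential
vanish. On faces of types X and Y both composites are zero, so only the rules for types A and C
enter.

The topological input is that a one-handle either merges two circles or splits one. This uses
planarity: Euler's formula forces the first homology modulo two of the cell structure given by the
diagram to vanish, whence a checkerboard colouring (`exists_coloring`). The colouring directs the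
circles of all resolutions coherently, and a change of resolution exchanges two values of the
permutation that walks along them. Such an exchange cuts a cycle in two or joins two cycles.

The statement on homology is the universal coefficient theorem. For a complex without 2-torsion, the
homology modulo two is an extension of the 2-torsion of H_{m+1} by H_m ⊗ ℤ/2. It splits because
every group in it is a vector space over ℤ/2, and `nonempty_torTwo_equiv` identifies the 2-torsion
with Tor. -/

noncomputable section
namespace OddKhovanov

/-! ### The checkerboard colouring of a planar diagram -/

/-- A function that is compatible with a relation agrees at an element and at the chosen
representative of its class. -/
lemma apply_quot_out {α β : Type*} {r : α → α → Prop} (g : α → β)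
    (h : ∀ a b, r a b → g a = g b) (a : α) : g (Quot.mk r a).out = g a :=
  congrArg (Quot.lift g h) (Quot.out_eq (Quot.mk r a))

namespace LinkDiagram

variable (D : LinkDiagram)

/-- The faces of the plane graph: a face is represented by the darts that have it on their right. -/
abbrev FaceQuot : Type := Quot fun d e : Dart D.n => e = rotate (D.opp d)

/-- The connected components of the underlying graph. -/
abbrev CompQuot : Type := Quot fun d e : Dart D.n => e = D.opp d ∨ e = rotate d

/-- The edges of the graph, each represented by its outgoing dart. -/
abbrev OutDart : Type := {d : Dart D.n // IsOutgoing D.positive d}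

instance : Fintype D.FaceQuot := Fintype.ofFinite _

instance : Fintype D.CompQuot := Fintype.ofFinite _

lemma faceQuot_rotate (d : Dart D.n) :
    (Quot.mk _ (rotate d) : D.FaceQuot) = Quot.mk _ (D.opp d) :=
  (Quot.sound (by rw [D.opp_opp])).symm

-- `D.opp` exchanges outgoing and incoming darts, so half of the 4n darts are outgoing.
open Classical in
lemma card_outDart : Fintype.card D.OutDart = 2 * D.n := by
  have h : Fintype.card D.OutDart = Fintype.card {d // ¬ IsOutgoing D.positive d} :=
    Fintype.card_congr
      { toFun := fun d => ⟨D.opp d.1, by rw [D.oriented]; exact not_not.2 d.2⟩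
        invFun := fun d => ⟨D.opp d.1, by rw [D.oriented]; exact d.2⟩
        left_inv := fun d => Subtype.ext (D.opp_opp _)
        right_inv := fun d => Subtype.ext (D.opp_opp _) }
  have h₂ := Fintype.card_subtype_compl (fun d => IsOutgoing D.positive d)
  have h₃ := Fintype.card_subtype_le (fun d => IsOutgoing D.positive d)
  have h₄ : Fintype.card (Dart D.n) = D.n * 4 := by simp
  simp only [OutDart] at *
  omega

open Classical in
/-- Extension of a function on edges to all darts. -/
def edgeExt : (D.OutDart → ZMod 2) →ₗ[ZMod 2] (Dart D.n → ZMod 2) where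
  toFun g d := if h : IsOutgoing D.positive d then g ⟨d, h⟩
    else g ⟨D.opp d, (D.oriented d).2 h⟩
  map_add' f g := by
    funext d; simp only [Pi.add_apply]; split_ifs <;> rfl
  map_smul' a g := by
    funext d; simp only [Pi.smul_apply, RingHom.id_apply]; split_ifs <;> rfl

/-- The boundary of a 1-chain with coefficients modulo two. -/
def edgeBoundary : (D.OutDart → ZMod 2) →ₗ[ZMod 2] (Fin D.n → ZMod 2) where
  toFun g v := ∑ i : Fin 4, D.edgeExt g (v, i)
  map_add' f g := by funext v; simp [Finset.sum_add_distrib]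
  map_smul' a g := by funext v; simp [Finset.mul_sum]

/-- The boundary of a 2-chain with coefficients modulo two. -/
def faceBoundary : (D.FaceQuot → ZMod 2) →ₗ[ZMod 2] (D.OutDart → ZMod 2) where
  toFun f d := f (Quot.mk _ d.1) + f (Quot.mk _ (D.opp d.1))
  map_add' f g := by funext v; simp only [Pi.add_apply]; ring
  map_smul' a g := by funext v; simp [mul_add]

lemma edgeExt_faceBoundary (f : D.FaceQuot → ZMod 2) (d : Dart D.n) :
    D.edgeExt (D.faceBoundary f) d = f (Quot.mk _ d) + f (Quot.mk _ (D.opp d)) := by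
  simp only [edgeExt, faceBoundary, LinearMap.coe_mk, AddHom.coe_mk]
  split_ifs
  · rfl
  · rw [D.opp_opp, add_comm]

/-- Each of the four corners at a vertex borders two of the four ends there, so its face is counted
twice. -/
lemma edgeBoundary_faceBoundary (f : D.FaceQuot → ZMod 2) :
    D.edgeBoundary (D.faceBoundary f) = 0 := by
  funext v
  have h (x : ZMod 2) : x + x = 0 := CharTwo.add_self_eq_zero x
  have h₀ : (Quot.mk _ (v, 1) : D.FaceQuot) = Quot.mk _ (D.opp (v, 0)) :=
    D.faceQuot_rotate (v, 0)
  have h₁ : (Quot.mk _ (v, 2) : D.FaceQuot) = Quot.mk _ (D.opp (v, 1)) :=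
    D.faceQuot_rotate (v, 1)
  have h₂ : (Quot.mk _ (v, 3) : D.FaceQuot) = Quot.mk _ (D.opp (v, 2)) :=
    D.faceQuot_rotate (v, 2)
  have h₃ : (Quot.mk _ (v, 0) : D.FaceQuot) = Quot.mk _ (D.opp (v, 3)) :=
    D.faceQuot_rotate (v, 3)
  simp only [edgeBoundary, LinearMap.coe_mk, AddHom.coe_mk, edgeExt_faceBoundary, Pi.zero_apply,
    Fin.sum_univ_four, ← h₀, ← h₁, ← h₂, ← h₃]
  linear_combination h (f (Quot.mk _ (v, 0))) + h (f (Quot.mk _ (v, 1))) +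
    h (f (Quot.mk _ (v, 2))) + h (f (Quot.mk _ (v, 3)))

/-- Every vertex has four ends, and 4 = 0 modulo two. -/
lemma edgeBoundary_one : D.edgeBoundary 1 = 0 := by
  funext v
  have (d : Dart D.n) : D.edgeExt 1 d = 1 := by
    simp only [edgeExt, LinearMap.coe_mk, AddHom.coe_mk]; split_ifs <;> rfl
  simp only [edgeBoundary, LinearMap.coe_mk, AddHom.coe_mk, this]
  rfl

-- A 2-chain with zero boundary takes the same value on both sides of every edge, hence is constant
-- on each connected component.
open Classical in
lemma finrank_ker_faceBoundary_le :
    Module.finrank (ZMod 2) (LinearMap.ker D.faceBoundary) ≤ Nat.card D.CompQuot := by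
  let r : LinearMap.ker D.faceBoundary →ₗ[ZMod 2] (D.CompQuot → ZMod 2) :=
    { toFun := fun f c => f.1 (Quot.mk _ c.out)
      map_add' := fun _ _ => rfl
      map_smul' := fun _ _ => rfl }
  have hr (f : LinearMap.ker D.faceBoundary) (d : Dart D.n) :
      r f (Quot.mk _ d) = f.1 (Quot.mk _ d) := by
    have hopp (d : Dart D.n) : f.1 (Quot.mk _ d) = f.1 (Quot.mk _ (D.opp d)) := by
      have := D.edgeExt_faceBoundary f.1 d
      rw [LinearMap.mem_ker.1 f.2, map_zero] at this
      exact CharTwo.add_eq_zero.1 this.symm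
    refine apply_quot_out (fun d => f.1 (Quot.mk _ d)) ?_ d
    rintro a b (rfl | rfl)
    · exact hopp a
    · rw [faceQuot_rotate]; exact hopp a
  have hinj : Function.Injective r := by
    intro f g hfg
    refine Subtype.ext (funext fun q => ?_)
    induction q using Quot.ind with | mk d => rw [← hr, ← hr, hfg]
  have := LinearMap.finrank_le_finrank_of_injective hinj
  rwa [Module.finrank_fintype_fun_eq_card, Fintype.card_eq_nat_card] at this

-- The two endpoints of an edge are identified in the cokernel of the boundary, which is therefore
-- spanned by one vertex from each component.
open Classical in
lemma le_finrank_range_edgeBoundary :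
    D.n ≤ Module.finrank (ZMod 2) (LinearMap.range D.edgeBoundary) + Nat.card D.CompQuot := by
  let δ (v : Fin D.n) : Fin D.n → ZMod 2 := Pi.single v 1
  let W := LinearMap.range D.edgeBoundary
  have hself (x : Fin D.n → ZMod 2) : x + x = 0 :=
    funext fun v => CharTwo.add_self_eq_zero (x v)
  have hδ (d : Dart D.n) : δ d.1 + δ (D.opp d).1 ∈ W := by
    wlog hd : IsOutgoing D.positive d generalizing d
    · have := this (D.opp d) ((D.oriented d).2 hd)
      rwa [D.opp_opp, add_comm] at this
    refine ⟨Pi.single ⟨d, hd⟩ 1, ?_⟩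
    have hne : D.opp d ≠ d := fun h => (D.oriented d).1 (by rwa [h]) hd
    have hod (e : Dart D.n) : D.opp e = d ↔ e = D.opp d :=
      ⟨fun h => by rw [← h, D.opp_opp], fun h => by rw [h, D.opp_opp]⟩
    have key (e : Dart D.n) : D.edgeExt (Pi.single ⟨d, hd⟩ 1) e =
        (if e = d then 1 else 0) + (if e = D.opp d then 1 else 0) := by
      simp only [edgeExt, LinearMap.coe_mk, AddHom.coe_mk, Pi.single_apply, Subtype.mk.injEq]
      by_cases h₁ : e = d
      · subst h₁
        simp [hd, hne.symm]
      · by_cases h₂ : e = D.opp d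
        · subst h₂
          simp [hne, D.oriented, hd, D.opp_opp]
        · simp [h₁, h₂, hod]
    funext v
    simp only [edgeBoundary, LinearMap.coe_mk, AddHom.coe_mk, key, Finset.sum_add_distrib,
      Pi.add_apply, δ, Pi.single_apply]
    have (d : Dart D.n) : (∑ i : Fin 4, if (v, i) = d then (1 : ZMod 2) else 0) =
        if v = d.1 then 1 else 0 := by
      obtain ⟨w, j⟩ := d
      by_cases h : v = w <;> simp [h]
    rw [this, this]
  have hW (d : Dart D.n) :
      W.mkQ (δ (Quot.mk (fun d e : Dart D.n => e = D.opp d ∨ e = rotate d) d).out.1) =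
        W.mkQ (δ d.1) := by
    refine apply_quot_out (fun d : Dart D.n => W.mkQ (δ d.1)) ?_ d
    rintro a b (rfl | rfl)
    · refine (Submodule.Quotient.eq _).2 ?_
      have := hδ a
      rwa [← neg_eq_of_add_eq_zero_left (hself (δ (D.opp a).1)), ← sub_eq_add_neg] at this
    · rfl
  let R : (D.CompQuot → ZMod 2) →ₗ[ZMod 2] ((Fin D.n → ZMod 2) ⧸ W) :=
    Fintype.linearCombination (ZMod 2) fun c => W.mkQ (δ c.out.1)
  have hR : LinearMap.range R = ⊤ := by
    rw [Fintype.range_linearCombination, eq_top_iff, ← Submodule.range_mkQ W,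
      LinearMap.range_eq_map, ← (Pi.basisFun (ZMod 2) (Fin D.n)).span_eq, Submodule.map_span,
      Submodule.span_le]
    rintro _ ⟨_, ⟨v, rfl⟩, rfl⟩
    rw [Pi.basisFun_apply]
    exact Submodule.subset_span ⟨Quot.mk _ (v, 0), hW (v, 0)⟩
  have h₁ := LinearMap.finrank_range_le R
  have h₂ := Submodule.finrank_quotient_add_finrank W
  rw [hR, finrank_top, Module.finrank_fintype_fun_eq_card, Fintype.card_eq_nat_card] at h₁
  rw [Module.finrank_fintype_fun_eq_card, Fintype.card_fin] at h₂
  change D.n ≤ Module.finrank (ZMod 2) W + _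
  omega

/-- Modulo two the constant 1-chain is the boundary of a 2-chain. -/
lemma exists_faceBoundary_eq_one : ∃ f, D.faceBoundary f = 1 := by
  classical
  have hle : LinearMap.range D.faceBoundary ≤ LinearMap.ker D.edgeBoundary := by
    rintro _ ⟨f, rfl⟩
    exact D.edgeBoundary_faceBoundary f
  have h₁ := LinearMap.finrank_range_add_finrank_ker D.faceBoundary
  have h₂ := LinearMap.finrank_range_add_finrank_ker D.edgeBoundary
  have h₃ := D.finrank_ker_faceBoundary_le
  have h₄ := D.le_finrank_range_edgeBoundary
  have h₅ : (D.n : ℤ) - 2 * D.n + Nat.card D.FaceQuot = 2 * Nat.card D.CompQuot := D.planar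
  rw [Module.finrank_fintype_fun_eq_card, Fintype.card_eq_nat_card] at h₁
  rw [Module.finrank_fintype_fun_eq_card, card_outDart] at h₂
  -- With C components and F faces, Euler's formula reads F = n + 2C. So the rank of `faceBoundary`
  -- is at least F - C = n + C, while the kernel of `edgeBoundary` has dimension at most 2n - (n -
  -- C) = n + C.
  have heq := Submodule.eq_of_le_of_finrank_le hle (by omega)
  have : (1 : D.OutDart → ZMod 2) ∈ LinearMap.ker D.edgeBoundary := D.edgeBoundary_one
  rw [← heq] at this
  exact this

/-- A planar diagram has a checkerboard colouring. The value at a dart is the colour of the face on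
its right. -/
lemma exists_coloring : ∃ χ : Dart D.n → ZMod 2,
    (∀ d, χ (D.opp d) = χ d + 1) ∧ ∀ d, χ (rotate d) = χ d + 1 := by
  obtain ⟨f, hf⟩ := D.exists_faceBoundary_eq_one
  have h (d : Dart D.n) : f (Quot.mk _ (D.opp d)) = f (Quot.mk _ d) + 1 := by
    have := D.edgeExt_faceBoundary f d
    have hone : D.edgeExt 1 d = 1 := by
      simp only [edgeExt, LinearMap.coe_mk, AddHom.coe_mk]; split_ifs <;> rfl
    rw [hf, hone] at this
    rw [this, ← add_assoc, CharTwo.add_self_eq_zero, zero_add]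
  -- The dart `rotate d` has the same face on its right as `D.opp d`, so both conditions express the
  -- colour change across one edge.
  exact ⟨fun d => f (Quot.mk _ d), h, fun d =>
    (congrArg f (D.faceQuot_rotate d)).trans (h d)⟩

end LinkDiagram
end OddKhovanov
end

noncomputable section
namespace OddKhovanov

/-! ### Exchanging two values of a permutation -/

section PermSwap

variable {α : Type*} [Finite α] {σ τ : Equiv.Perm α} {x y : α} {P : α → Prop}

/-- From y, τ jumps to σ x and then follows σ until it is back at y, without meeting x: the cycle
has been cut. The predicate P confines the comparison to an invariant set, in the application the
darts of one colour. -/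
lemma not_sameCycle_of_swap (hσ : ∀ a, P a → P (σ a)) (hx : P x) (hxy : x ≠ y) (hτy : τ y = σ x)
    (hτ : ∀ a, P a → a ≠ x → a ≠ y → τ a = σ a) (h : σ.SameCycle x y) : ¬ τ.SameCycle x y := by
  classical
  have hex : ∃ k, (σ ^ k) x = y := h.exists_nat_pow_eq
  set k := Nat.find hex with hk
  have hky : (σ ^ k) x = y := Nat.find_spec hex
  have hmin (j : ℕ) (hj : j < k) : (σ ^ j) x ≠ y := Nat.find_min hex hj
  have hk0 : k ≠ 0 := fun h0 => hxy (by simpa [h0] using hky)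
  have hP (j : ℕ) : P ((σ ^ j) x) := by
    induction j with
    | zero => exact hx
    | succ j ih => rw [pow_succ', Equiv.Perm.mul_apply]; exact hσ _ ih
  have hne (j : ℕ) (hj : 1 ≤ j) (hjk : j ≤ k) : (σ ^ j) x ≠ x := by
    intro he
    refine hmin (k - j) (by omega) ?_
    rw [← hky]
    conv_rhs => rw [← Nat.sub_add_cancel hjk, pow_add, Equiv.Perm.mul_apply, he]
  intro hs
  obtain ⟨m, hm⟩ := hs.symm.exists_nat_pow_eq
  -- The arc σ x, …, σ^k x = y is closed under τ and, by minimality of k, does not contain x.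
  have hS (m : ℕ) : ∃ j, 1 ≤ j ∧ j ≤ k ∧ (τ ^ m) y = (σ ^ j) x := by
    induction m with
    | zero => exact ⟨k, by omega, le_rfl, hky.symm⟩
    | succ m ih =>
      obtain ⟨j, h1, h2, h3⟩ := ih
      rw [pow_succ', Equiv.Perm.mul_apply, h3]
      rcases h2.eq_or_lt with rfl | h2
      · rw [hky, hτy]
        exact ⟨1, le_rfl, by omega, by simp⟩
      · refine ⟨j + 1, by omega, h2, ?_⟩
        rw [hτ _ (hP j) (hne j h1 h2.le) (hmin j h2), pow_succ', Equiv.Perm.mul_apply]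
  obtain ⟨j, h1, h2, h3⟩ := hS m
  exact hne j h1 h2 (by rw [← h3, hm])

/-- From y, τ jumps to σ x and then runs through the σ-cycle of x. That cycle does not contain y, so
τ follows it up to x, after as many steps as the length k + 1 of the cycle. -/
lemma sameCycle_of_swap (hσ : ∀ a, P a → P (σ a)) (hx : P x) (hτy : τ y = σ x)
    (hτ : ∀ a, P a → a ≠ x → a ≠ y → τ a = σ a) (h : ¬ σ.SameCycle x y) : τ.SameCycle x y := by
  classical
  have hex : ∃ k, (σ ^ (k + 1)) x = x := by
    obtain ⟨k, hk, hk'⟩ := isOfFinOrder_iff_pow_eq_one.1 (isOfFinOrder_of_finite σ)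
    exact ⟨k - 1, by rw [Nat.sub_add_cancel hk, hk']; rfl⟩
  set k := Nat.find hex with hk
  have hkx : (σ ^ (k + 1)) x = x := Nat.find_spec hex
  have hmin (j : ℕ) (hj : j < k) : (σ ^ (j + 1)) x ≠ x := Nat.find_min hex hj
  have hP (j : ℕ) : P ((σ ^ j) x) := by
    induction j with
    | zero => exact hx
    | succ j ih => rw [pow_succ', Equiv.Perm.mul_apply]; exact hσ _ ih
  have key (j : ℕ) (hj : j ≤ k) : (τ ^ (j + 1)) y = (σ ^ (j + 1)) x := by
    induction j with
    | zero => simpa using hτy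
    | succ j ih =>
      rw [pow_succ', Equiv.Perm.mul_apply, ih (by omega),
        hτ _ (hP _) (hmin j (by omega)) fun he => h ⟨(j + 1 : ℕ), by rw [zpow_natCast]; exact he⟩]
      rw [pow_succ' σ (j + 1), Equiv.Perm.mul_apply]
  exact Equiv.Perm.SameCycle.symm ⟨(k + 1 : ℕ), by rw [zpow_natCast, key k le_rfl, hkx]⟩

end PermSwap

namespace LinkDiagram

variable (D : LinkDiagram)

/-! ### Circles as orbits of the walk -/

lemma smooth_smooth (I : D.Vertex) (d : Dart D.n) : D.smooth I (D.smooth I d) = d := by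
  obtain ⟨c, i⟩ := d
  simp only [smooth]
  split_ifs <;> fin_cases i <;> rfl

/-- The walk along the circles of a resolution, as a permutation of the darts. -/
def stepPerm (I : D.Vertex) : Equiv.Perm (Dart D.n) where
  toFun := D.step I
  invFun d := D.smooth I (D.opp d)
  left_inv d := by simp [step, D.opp_opp, smooth_smooth]
  right_inv d := by simp [step, D.opp_opp, smooth_smooth]

lemma stepPerm_apply (I : D.Vertex) (d : Dart D.n) : D.stepPerm I d = D.opp (D.smooth I d) := rfl

lemma circ_opp (I : D.Vertex) (d : Dart D.n) : D.circ I (D.opp d) = D.circ I d :=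
  congrArg Sum.inl (Quot.sound (r := fun d e : Dart D.n => e = D.opp d ∨ e = D.smooth I d)
    (Or.inl rfl)).symm

lemma circ_smooth (I : D.Vertex) (d : Dart D.n) : D.circ I (D.smooth I d) = D.circ I d :=
  congrArg Sum.inl (Quot.sound (r := fun d e : Dart D.n => e = D.opp d ∨ e = D.smooth I d)
    (Or.inr rfl)).symm

/-- A function that is invariant along the strands of a resolution is constant on its circles. -/
lemma apply_eq_of_circ_eq {β : Type*} {I : D.Vertex} (g : Dart D.n → β)
    (hopp : ∀ d, g (D.opp d) = g d) (hsm : ∀ d, g (D.smooth I d) = g d) {d e : Dart D.n}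
    (h : D.circ I d = D.circ I e) : g d = g e := by
  have hg : ∀ a b : Dart D.n, (b = D.opp a ∨ b = D.smooth I a) → g a = g b := by
    rintro a b (rfl | rfl)
    · exact (hopp a).symm
    · exact (hsm a).symm
  exact congrArg (Quot.lift g hg) (Sum.inl.inj h)

lemma circ_eq_of_sameCycle {I : D.Vertex} {d e : Dart D.n} (h : (D.stepPerm I).SameCycle d e) :
    D.circ I d = D.circ I e := by
  obtain ⟨k, rfl⟩ := h.exists_nat_pow_eq
  induction k with
  | zero => rfl
  | succ k ih =>
    rw [pow_succ', Equiv.Perm.mul_apply, stepPerm_apply, circ_opp, circ_smooth]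
    exact ih ⟨k, by simp⟩

/-- The two parts of a checkerboard colouring. -/
structure IsColoring (χ : Dart D.n → ZMod 2) : Prop where
  opp : ∀ d, χ (D.opp d) = χ d + 1
  rotate : ∀ d, χ (rotate d) = χ d + 1

variable {D}

namespace IsColoring

variable {χ : Dart D.n → ZMod 2}

lemma eq_add (hχ : D.IsColoring χ) (c : Fin D.n) :
    χ (c, 1) = χ (c, 0) + 1 ∧ χ (c, 2) = χ (c, 0) ∧ χ (c, 3) = χ (c, 0) + 1 := by
  have h1 : χ (c, 1) = χ (c, 0) + 1 := hχ.rotate (c, 0)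
  have h2 : χ (c, 2) = χ (c, 1) + 1 := hχ.rotate (c, 1)
  have h3 : χ (c, 3) = χ (c, 2) + 1 := hχ.rotate (c, 2)
  have h2' : χ (c, 2) = χ (c, 0) := by
    rw [h2, h1, add_assoc, CharTwo.add_self_eq_zero, add_zero]
  exact ⟨h1, h2', by rw [h3, h2']⟩

lemma smooth (hχ : D.IsColoring χ) (I : D.Vertex) (d : Dart D.n) : χ (D.smooth I d) = χ d + 1 := by
  obtain ⟨c, i⟩ := d
  obtain ⟨h1, h2, h3⟩ := hχ.eq_add c
  have hz (a : ZMod 2) : a = a + 1 + 1 := by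
    rw [add_assoc, CharTwo.add_self_eq_zero, add_zero]
  simp only [LinkDiagram.smooth]
  split_ifs <;> fin_cases i <;> simp [h1, h2, h3, ← hz]

/-- The smoothing and the edge each change the colour once. Hence a colour selects one direction of
travel on every circle. -/
lemma step (hχ : D.IsColoring χ) (I : D.Vertex) (d : Dart D.n) : χ (D.stepPerm I d) = χ d := by
  rw [stepPerm_apply, hχ.opp, hχ.smooth, add_assoc, CharTwo.add_self_eq_zero, add_zero]

/-- Two darts of the same colour lie on the same circle iff the walk leads from one to the other. -/
lemma sameCycle (hχ : D.IsColoring χ) {I : D.Vertex} {d e : Dart D.n} (h : D.circ I d = D.circ I e)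
    (hc : χ e = χ d) : (D.stepPerm I).SameCycle d e := by
  -- An invariant of the whole circle: the walk from `d` arrives at `a` or, if `a` has the other
  -- colour, at the end to which `a` is joined by the resolution.
  let Q (a : Dart D.n) : Prop :=
    (χ a = χ d ∧ (D.stepPerm I).SameCycle d a) ∨
      (χ a ≠ χ d ∧ (D.stepPerm I).SameCycle d (D.smooth I a))
  have hz (a : ZMod 2) : a + 1 ≠ a := by simp
  have hz' (a b : ZMod 2) (h : a ≠ b) : a + 1 = b := by revert a b; decide
  have hQs (a : Dart D.n) (ha : Q a) : Q (D.smooth I a) := by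
    rcases ha with ⟨h1, h2⟩ | ⟨h1, h2⟩
    · exact Or.inr ⟨by rw [hχ.smooth, h1]; exact hz _, by rwa [D.smooth_smooth]⟩
    · exact Or.inl ⟨by rw [hχ.smooth]; exact hz' _ _ h1, h2⟩
  have hQo (a : Dart D.n) (ha : Q a) : Q (D.opp a) := by
    rcases ha with ⟨h1, h2⟩ | ⟨h1, h2⟩
    · refine Or.inr ⟨by rw [hχ.opp, h1]; exact hz _, ?_⟩
      rw [← Equiv.Perm.sameCycle_apply_right, stepPerm_apply, D.smooth_smooth, D.opp_opp]
      exact h2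
    · rw [← Equiv.Perm.sameCycle_apply_right, stepPerm_apply, D.smooth_smooth] at h2
      exact Or.inl ⟨by rw [hχ.opp]; exact hz' _ _ h1, h2⟩
  have := D.apply_eq_of_circ_eq Q
    (fun a => propext ⟨fun h => by simpa [D.opp_opp] using hQo _ h, hQo a⟩)
    (fun a => propext ⟨fun h => by simpa [D.smooth_smooth] using hQs _ h, hQs a⟩) h
  have hd : Q d := Or.inl ⟨rfl, .refl _ _⟩
  rw [this] at hd
  rcases hd with h | h
  · exact h.2
  · exact absurd hc h.1

end IsColoring

/-! ### Merges and splits -/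

/-- `J` is obtained from `I` by changing the resolution at `c` from 0 to 1. -/
structure IsFlip (I J : D.Vertex) (c : Fin D.n) : Prop where
  src : I c = false
  tgt : J c = true
  of_ne : ∀ x, x ≠ c → J x = I x

lemma isFlip_update {I : D.Vertex} {c : Fin D.n} (h : I c = false) :
    IsFlip I (Function.update I c true) c :=
  ⟨h, by simp, fun x hx => by simp [hx]⟩

namespace IsFlip

variable {I J : D.Vertex} {c : Fin D.n}

lemma smooth_of_ne (h : IsFlip I J c) {d : Dart D.n} (hd : d.1 ≠ c) :
    D.smooth J d = D.smooth I d := by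
  simp only [smooth, h.of_ne _ hd]

lemma circ_src₁ (h : IsFlip I J c) : D.circ I (c, 1) = D.circ I (c, 0) := by
  rw [← D.circ_smooth I (c, 0)]; simp [smooth, h.src]

lemma circ_src₃ (h : IsFlip I J c) : D.circ I (c, 3) = D.circ I (c, 2) := by
  rw [← D.circ_smooth I (c, 2)]; simp [smooth, h.src]

lemma circ_tgt₀ (h : IsFlip I J c) : D.circ J (c, 0) = D.circ J (c, 3) := by
  rw [← D.circ_smooth J (c, 3)]; simp [smooth, h.tgt]

lemma circ_tgt₂ (h : IsFlip I J c) : D.circ J (c, 2) = D.circ J (c, 1) := by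
  rw [← D.circ_smooth J (c, 1)]; simp [smooth, h.tgt]

lemma step₂ (h : IsFlip I J c) : D.stepPerm J (c, 2) = D.stepPerm I (c, 0) := by
  simp [stepPerm_apply, smooth, h.src, h.tgt]

/-- Ends 1 and 3 of `c` have the opposite colour, so a walk in the colour of end 0 feels the changed
resolution only at ends 0 and 2. -/
lemma step_of_ne (h : IsFlip I J c) {χ : Dart D.n → ZMod 2} (hχ : D.IsColoring χ) (d : Dart D.n)
    (hd : χ d = χ (c, 0)) (h0 : d ≠ (c, 0)) (h2 : d ≠ (c, 2)) :
    D.stepPerm J d = D.stepPerm I d := by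
  rw [stepPerm_apply, stepPerm_apply, h.smooth_of_ne]
  rintro rfl
  obtain ⟨h1, -, h3⟩ := hχ.eq_add d.1
  obtain ⟨c, i⟩ := d
  fin_cases i <;> simp_all

/-- A one-handle that has both feet on one circle splits it. -/
lemma circ_ne (h : IsFlip I J c) (hI : D.circ I (c, 0) = D.circ I (c, 2)) :
    D.circ J (c, 1) ≠ D.circ J (c, 3) := by
  obtain ⟨χ, h1, h2⟩ := D.exists_coloring
  have hχ : D.IsColoring χ := ⟨h1, h2⟩
  intro hJ
  rw [← h.circ_tgt₀, ← h.circ_tgt₂] at hJ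
  obtain ⟨-, hc, -⟩ := hχ.eq_add c
  exact not_sameCycle_of_swap (P := fun d => χ d = χ (c, 0)) (fun a ha => by rw [hχ.step, ha]) rfl
    (by simp) h.step₂ (h.step_of_ne hχ) (hχ.sameCycle hI hc) (hχ.sameCycle hJ.symm hc)

/-- A one-handle that has its feet on different circles merges them. -/
lemma circ_eq (h : IsFlip I J c) (hI : D.circ I (c, 0) ≠ D.circ I (c, 2)) :
    D.circ J (c, 1) = D.circ J (c, 3) := by
  obtain ⟨χ, h1, h2⟩ := D.exists_coloring
  have hχ : D.IsColoring χ := ⟨h1, h2⟩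
  rw [← h.circ_tgt₀, ← h.circ_tgt₂]
  exact (D.circ_eq_of_sameCycle (sameCycle_of_swap (P := fun d => χ d = χ (c, 0))
    (fun a ha => by rw [hχ.step, ha]) rfl h.step₂ (h.step_of_ne hχ)
    fun hs => hI (D.circ_eq_of_sameCycle hs))).symm

end IsFlip

/-! ### Circles as classes of generators -/

variable (D)

/-- Every circle contains a dart or meets no crossing. -/
abbrev Gen : Type := Dart D.n ⊕ Fin D.loops

variable {D}

/-- The circle of a resolution that is represented by a dart or by a component without crossings. -/
def cir (I : D.Vertex) : D.Gen → D.Circle I := Sum.elim (D.circ I) Sum.inr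

@[simp] lemma cir_inl (I : D.Vertex) (d : Dart D.n) : cir I (Sum.inl d) = D.circ I d := rfl

@[simp] lemma cir_inr (I : D.Vertex) (l : Fin D.loops) : cir I (Sum.inr l) = Sum.inr l := rfl

lemma cir_surjective (I : D.Vertex) : Function.Surjective (cir I) := by
  rintro (q | l)
  · induction q using Quot.ind with | mk d => exact ⟨Sum.inl d, rfl⟩
  · exact ⟨Sum.inr l, rfl⟩

/-- The circles of `I` are obtained from those of `J` by identifying `cir J a` and `cir J b`. -/
structure IsMerge (J I : D.Vertex) (a b : D.Gen) : Prop where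
  ne : cir J a ≠ cir J b
  eq_iff : ∀ x y, cir I x = cir I y ↔ cir J x = cir J y ∨
    (cir J x = cir J a ∧ cir J y = cir J b) ∨ (cir J x = cir J b ∧ cir J y = cir J a)

namespace IsFlip

variable {I J : D.Vertex} {c : Fin D.n}

/-- If two resolutions have the same smoothings except at `c`, and the four ends at `c` lie on one
circle of `J`, then the circles of `J` are those of `I` with identifications at `c`. -/
lemma circ_cases {I J : D.Vertex} {c : Fin D.n} {a b : Dart D.n}
    (hsm : ∀ d : Dart D.n, d.1 ≠ c → D.smooth I d = D.smooth J d)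
    (hc : ∀ i, D.circ J (c, i) = D.circ J a ∨ D.circ J (c, i) = D.circ J b)
    (x y : Dart D.n) (h : D.circ I x = D.circ I y) :
    D.circ J x = D.circ J y ∨ (D.circ J x = D.circ J a ∧ D.circ J y = D.circ J b) ∨
      (D.circ J x = D.circ J b ∧ D.circ J y = D.circ J a) := by
  -- Collapsing the circles of `a` and `b` to one point gives a function that no longer sees the
  -- resolution at `c`, hence is constant on the circles of `I`.
  let g (d : Dart D.n) : Option (D.Circle J) := by
    classical exact if D.circ J d = D.circ J a ∨ D.circ J d = D.circ J b then none
      else some (D.circ J d)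
  have hg : g x = g y := by
    refine D.apply_eq_of_circ_eq g (fun d => ?_) (fun d => ?_) h
    · simp only [g]
      rw [D.circ_opp]
    · by_cases hd : d.1 = c
      · have h1 := hc d.2
        have h2 := hc (D.smooth I d).2
        rw [← hd] at h1 h2
        have h2' : D.circ J (D.smooth I d) = D.circ J a ∨ D.circ J (D.smooth I d) = D.circ J b := h2
        have h1' : D.circ J d = D.circ J a ∨ D.circ J d = D.circ J b := h1
        simp only [g, h1', h2', if_true]
      · simp only [g]
        rw [hsm d hd, D.circ_smooth]
  simp only [g] at hg
  split_ifs at hg with h1 h2 h3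
  · rcases h1 with h1 | h1 <;> rcases h2 with h2 | h2 <;> simp [h1, h2]
  · exact Or.inl (Option.some.inj hg)

/-- If two resolutions have the same smoothings except at `c`, the four ends at `c` lie on one
circle of `I` and on two circles of `J`, then the latter are merged. -/
lemma isMerge_of {I J : D.Vertex} {c : Fin D.n} {i j : Fin 4}
    (hsm : ∀ d : Dart D.n, d.1 ≠ c → D.smooth I d = D.smooth J d)
    (hne : D.circ J (c, i) ≠ D.circ J (c, j))
    (hc : ∀ k, D.circ J (c, k) = D.circ J (c, i) ∨ D.circ J (c, k) = D.circ J (c, j))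
    (hI : ∀ k, D.circ I (c, k) = D.circ I (c, 0)) :
    IsMerge J I (Sum.inl (c, i)) (Sum.inl (c, j)) := by
  refine ⟨hne, ?_⟩
  have hle (x y : Dart D.n) (h : D.circ J x = D.circ J y) : D.circ I x = D.circ I y := by
    refine D.apply_eq_of_circ_eq (D.circ I) (D.circ_opp I) (fun d => ?_) h
    by_cases hd : d.1 = c
    · subst hd
      exact (hI (D.smooth J d).2).trans (hI d.2).symm
    · rw [← hsm d hd, D.circ_smooth]
  have hij (k l : Fin 4) : D.circ I (c, k) = D.circ I (c, l) := (hI k).trans (hI l).symm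
  rintro (x | x) (y | y)
  · simp only [cir_inl]
    refine ⟨circ_cases hsm hc x y, ?_⟩
    rintro (h | ⟨h1, h2⟩ | ⟨h1, h2⟩)
    · exact hle _ _ h
    · exact (hle _ _ h1).trans ((hij _ _).trans (hle _ _ h2).symm)
    · exact (hle _ _ h1).trans ((hij _ _).trans (hle _ _ h2).symm)
  · simp [circ]
  · simp [circ]
  · simp [circ]

/-- The circles of `J` obtained from those of `I` if the feet lie on different circles. -/
lemma isMerge (h : IsFlip I J c) (hI : D.circ I (c, 0) ≠ D.circ I (c, 2)) :
    IsMerge I J (Sum.inl (c, 0)) (Sum.inl (c, 2)) := by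
  have h13 := h.circ_eq hI
  refine isMerge_of (fun d hd => h.smooth_of_ne hd) hI (fun k => ?_) (fun k => ?_)
  · fin_cases k
    · exact Or.inl rfl
    · exact Or.inl h.circ_src₁
    · exact Or.inr rfl
    · exact Or.inr h.circ_src₃
  · fin_cases k
    · rfl
    · exact h13.trans h.circ_tgt₀.symm
    · exact h.circ_tgt₂.trans (h13.trans h.circ_tgt₀.symm)
    · exact h.circ_tgt₀.symm

/-- The circles of `I` obtained from those of `J` if the feet lie on the same circle. -/
lemma isMerge_symm (h : IsFlip I J c) (hI : D.circ I (c, 0) = D.circ I (c, 2)) :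
    IsMerge J I (Sum.inl (c, 1)) (Sum.inl (c, 3)) := by
  refine isMerge_of (fun d hd => (h.smooth_of_ne hd).symm) (h.circ_ne hI) (fun k => ?_)
    (fun k => ?_)
  · fin_cases k
    · exact Or.inr h.circ_tgt₀
    · exact Or.inl rfl
    · exact Or.inl h.circ_tgt₂
    · exact Or.inr rfl
  · fin_cases k
    · rfl
    · exact h.circ_src₁
    · exact hI.symm
    · exact h.circ_src₃.trans hI.symm

end IsFlip

namespace IsMerge

variable {I J : D.Vertex} {a b : D.Gen}

lemma le (h : IsMerge J I a b) {x y : D.Gen} (hxy : cir J x = cir J y) : cir I x = cir I y :=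
  (h.eq_iff x y).2 (Or.inl hxy)

lemma eq (h : IsMerge J I a b) : cir I a = cir I b :=
  (h.eq_iff a b).2 (Or.inr (Or.inl ⟨rfl, rfl⟩))

/-- A merge reduces the number of circles by one. -/
lemma card (h : IsMerge J I a b) :
    Fintype.card (D.Circle J) = Fintype.card (D.Circle I) + 1 := by
  classical
  -- Once the circle of `b` is left out, the merged circle has the circle of `a` as its only
  -- preimage.
  let f : {q : D.Circle J // q ≠ cir J b} → D.Circle I :=
    fun q => cir I (Function.surjInv (cir_surjective J) q.1)
  have hf (x : D.Gen) (hx : cir J x ≠ cir J b) : f ⟨cir J x, hx⟩ = cir I x :=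
    h.le (Function.surjInv_eq (cir_surjective J) _)
  have hbij : Function.Bijective f := by
    refine ⟨?_, fun q => ?_⟩
    · rintro ⟨p, hp⟩ ⟨q, hq⟩ hpq
      obtain ⟨x, rfl⟩ := cir_surjective J p
      obtain ⟨y, rfl⟩ := cir_surjective J q
      rw [hf, hf, h.eq_iff] at hpq
      refine Subtype.ext ?_
      tauto
    · obtain ⟨x, rfl⟩ := cir_surjective I q
      by_cases hx : cir J x = cir J b
      · exact ⟨⟨cir J a, h.ne⟩, by rw [hf, h.eq]; exact (h.le hx).symm⟩
      · exact ⟨⟨cir J x, hx⟩, hf x hx⟩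
  have h1 := Fintype.card_of_bijective hbij
  have h2 := Fintype.card_pos_iff.2 ⟨cir J b⟩
  rw [Fintype.card_subtype_compl, Fintype.card_subtype_eq] at h1
  omega

end IsMerge

end LinkDiagram
end OddKhovanov
end

noncomputable section
namespace OddKhovanov

namespace LinkDiagram

variable {D : LinkDiagram}

/-! ### Maps of one-handles and faces of the hypercube -/

section Handle

variable {E : D.Vertex → Type} [∀ I, AddCommGroup (E I)] {η : ℤ} {s : Fin D.n → ℤ}

/-- For each resolution a family of elements `π I l` that behaves like the products of
generators, which commute up to the factor `η`, indexed by the circles through the members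
of `l`. -/
structure IsProductFamily (η : ℤ) (π : ∀ I, List D.Gen → E I) : Prop where
  swap : ∀ I x y l, π I (x :: y :: l) = η • π I (y :: x :: l)
  congr : ∀ I x y l, cir I x = cir I y → π I (x :: l) = π I (y :: l)

/-- A map `E I → E J` that acts on products as the one-handle at `c`: a merge preserves them, a
split multiplies them by the sum, with coefficient `η`, of the two new circles. -/
structure IsHandleMap (η : ℤ) (s : Fin D.n → ℤ) (π : ∀ I, List D.Gen → E I) (I J : D.Vertex)
    (c : Fin D.n) (F : E I →ₗ[ℤ] E J) : Prop where
  merge : D.circ I (c, 0) ≠ D.circ I (c, 2) → ∀ l, F (π I l) = π J l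
  split : D.circ I (c, 0) = D.circ I (c, 2) → ∀ l,
    F (π I l) = s c • (π J (Sum.inl (c, 1) :: l) + η • π J (Sum.inl (c, 3) :: l))

lemma IsFlip.card_circle_of_ne {I J : D.Vertex} {c : Fin D.n} (h : IsFlip I J c)
    (hI : D.circ I (c, 0) ≠ D.circ I (c, 2)) :
    Fintype.card (D.Circle I) = Fintype.card (D.Circle J) + 1 :=
  (h.isMerge hI).card

lemma IsFlip.card_circle_of_eq {I J : D.Vertex} {c : Fin D.n} (h : IsFlip I J c)
    (hI : D.circ I (c, 0) = D.circ I (c, 2)) :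
    Fintype.card (D.Circle J) = Fintype.card (D.Circle I) + 1 :=
  (h.isMerge_symm hI).card

/-- The two composites around a square agree up to a factor. -/
lemma exists_comp_eq_smul {π : ∀ I, List D.Gen → E I} (hπ : IsProductFamily η π)
    (hη : η * η = 1) (hs : ∀ c, s c * s c = 1) {I J₁ J₂ K : D.Vertex} {x₁ x₂ : Fin D.n}
    (h₁ : IsFlip I J₁ x₁) (h₂ : IsFlip I J₂ x₂) (h₁' : IsFlip J₂ K x₁) (h₂' : IsFlip J₁ K x₂)
    {F₁ : E I →ₗ[ℤ] E J₁} {F₂ : E I →ₗ[ℤ] E J₂} {F₁' : E J₂ →ₗ[ℤ] E K} {F₂' : E J₁ →ₗ[ℤ] E K}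
    (H₁ : IsHandleMap η s π I J₁ x₁ F₁) (H₂ : IsHandleMap η s π I J₂ x₂ F₂)
    (H₁' : IsHandleMap η s π J₂ K x₁ F₁') (H₂' : IsHandleMap η s π J₁ K x₂ F₂') :
    ∃ κ : ℤ, (κ = 1 ∨ κ = η ∨ κ = s x₁ * s x₂ ∨ κ = s x₁ * s x₂ * η) ∧
      ∀ l, F₂' (F₁ (π I l)) = κ • F₁' (F₂ (π I l)) := by
  -- Each of the four edges is a merge or a split. Comparing the numbers of circles of `I` and `K`
  -- along both paths shows that they contain equally many splits, which leaves six of the sixteen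
  -- cases.
  by_cases c₁ : D.circ I (x₁, 0) = D.circ I (x₁, 2) <;>
  by_cases c₂ : D.circ I (x₂, 0) = D.circ I (x₂, 2) <;>
  by_cases c₁' : D.circ J₂ (x₁, 0) = D.circ J₂ (x₁, 2) <;>
  by_cases c₂' : D.circ J₁ (x₂, 0) = D.circ J₁ (x₂, 2)
  all_goals
    first
      | have n₁ := h₁.card_circle_of_eq c₁
      | have n₁ := h₁.card_circle_of_ne c₁
    first
      | have n₂ := h₂.card_circle_of_eq c₂
      | have n₂ := h₂.card_circle_of_ne c₂
    first
      | have n₁' := h₁'.card_circle_of_eq c₁'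
      | have n₁' := h₁'.card_circle_of_ne c₁'
    first
      | have n₂' := h₂'.card_circle_of_eq c₂'
      | have n₂' := h₂'.card_circle_of_ne c₂'
    first
      | (exfalso; omega)
      | clear n₁ n₂ n₁' n₂'
  · -- two splits
    refine ⟨η, by simp, fun l => ?_⟩
    simp only [H₁.split c₁, H₂.split c₂, H₁'.split c₁', H₂'.split c₂', map_smul, map_add]
    rw [hπ.swap K (.inl (x₂, 1)) (.inl (x₁, 1)), hπ.swap K (.inl (x₂, 1)) (.inl (x₁, 3)),
      hπ.swap K (.inl (x₂, 3)) (.inl (x₁, 1)), hπ.swap K (.inl (x₂, 3)) (.inl (x₁, 3))]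
    module
  · -- two splits followed by merges
    have m₁ := h₁.isMerge_symm c₁
    have m₂' := h₂'.isMerge c₂'
    have e := (m₁.eq_iff (.inl (x₂, 0)) (.inl (x₂, 2))).1 c₂
    have hK : cir K (.inl (x₁, 1)) = cir K (.inl (x₁, 3)) := by
      have := m₂'.eq
      rcases e with e | ⟨e1, e2⟩ | ⟨e1, e2⟩
      · exact absurd e c₂'
      · rw [← m₂'.le e1, ← m₂'.le e2, this]
      · rw [← m₂'.le e1, ← m₂'.le e2, this]
    have hK' : cir K (.inl (x₂, 1)) = cir K (.inl (x₁, 3)) := by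
      rw [cir_inl, ← h₂'.circ_tgt₂, ← cir_inl]
      rcases e with e | ⟨e1, e2⟩ | ⟨e1, e2⟩
      · exact absurd e c₂'
      · rw [m₂'.le e2]
      · rw [m₂'.le e2, hK]
    have hK'' : cir K (.inl (x₂, 3)) = cir K (.inl (x₁, 3)) :=
      (h₂'.circ_eq c₂').symm.trans hK'
    -- All new circles coincide in `K`, so both composites are 1 + η times the same product, up to
    -- the signs `s`. For η = -1 they vanish: these are the faces of types X and Y.
    refine ⟨s x₁ * s x₂, by simp, fun l => ?_⟩
    simp only [H₁.split c₁, H₂.split c₂, H₁'.merge c₁', H₂'.merge c₂', map_smul, map_add,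
      hπ.congr K _ _ l hK, hπ.congr K _ _ l hK', hπ.congr K _ _ l hK'', smul_smul]
    rw [mul_assoc, hs, mul_one]
  · exact ⟨1, by simp, fun l => by
      simp only [H₁.split c₁, H₂.merge c₂, H₁'.split c₁', H₂'.merge c₂', map_smul, map_add,
        one_smul]⟩
  · exact ⟨1, by simp, fun l => by
      simp only [H₁.merge c₁, H₂.split c₂, H₁'.merge c₁', H₂'.split c₂', map_smul, map_add,
        one_smul]⟩
  · -- two merges followed by splits
    have m₁ := h₁.isMerge c₁
    have m₂' := h₂'.isMerge_symm c₂'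
    have hJ : cir J₁ (.inl (x₁, 1)) = cir J₁ (.inl (x₁, 3)) := h₁.circ_eq c₁
    have hJ' : cir J₁ (.inl (x₁, 1)) = cir J₁ (.inl (x₂, 1)) := by
      have e := (m₁.eq_iff (.inl (x₂, 0)) (.inl (x₂, 2))).1 c₂'
      rw [cir_inl J₁ (x₁, 1), ← h₁.circ_tgt₂, cir_inl J₁ (x₂, 1), h₂'.circ_src₁, ← cir_inl,
        ← cir_inl]
      rcases e with e | ⟨e1, e2⟩ | ⟨e1, e2⟩
      · exact absurd e c₂
      · rw [m₁.le e1, m₁.eq]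
      · rw [m₁.le e1]
    have hne := h₁'.circ_ne c₁'
    have hf := (m₂'.eq_iff _ _).1 hJ
    have hg := (m₂'.eq_iff _ _).1 hJ'
    -- The two handles join the same two circles, so the final splits at `x₁` and `x₂` produce the
    -- same pair of circles. Whether the pairs match in the given or in the opposite order decides
    -- about the factor η.
    rcases hf with hf | ⟨f1, f2⟩ | ⟨f1, f2⟩
    · exact absurd hf hne
    · refine ⟨s x₁ * s x₂, by simp, fun l => ?_⟩
      simp only [H₁.merge c₁, H₂.merge c₂, H₁'.split c₁', H₂'.split c₂',
        hπ.congr K _ _ l f1, hπ.congr K _ _ l f2, smul_smul]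
      rw [mul_comm (s x₁), mul_assoc, hs, mul_one]
    · refine ⟨s x₁ * s x₂ * η, by simp, fun l => ?_⟩
      simp only [H₁.merge c₁, H₂.merge c₂, H₁'.split c₁', H₂'.split c₂',
        hπ.congr K _ _ l f1, hπ.congr K _ _ l f2, smul_smul, smul_add]
      have : s x₁ * s x₂ * η * s x₁ = η * s x₂ := by linear_combination η * s x₂ * hs x₁
      have h' : s x₁ * s x₂ * η * (s x₁ * η) = s x₂ := by
        linear_combination s x₂ * (η * η * hs x₁ + hη)
      rw [this, h', add_comm, mul_comm η]
  · exact ⟨1, by simp, fun l => by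
      simp only [H₁.merge c₁, H₂.merge c₂, H₁'.merge c₁', H₂'.merge c₂', one_smul]⟩

end Handle

/-! ### The square of a differential on the hypercube -/

namespace Face

/-- The face through two consecutive edges. -/
def ofPair (e e' : D.Edge) (h : e'.src = e.tgt) : D.Face where
  src := e.src
  x₁ := e.crossing
  x₂ := e'.crossing
  ne := by
    intro hx
    have := e'.2
    change e'.src e'.crossing = false at this
    rw [h, ← hx] at this
    simp [Edge.tgt] at this
  h₁ := e.2
  h₂ := by
    have := e'.2
    change e'.src e'.crossing = false at this
    rw [h, Edge.tgt, Function.update_apply] at this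
    split_ifs at this
    exact this

lemma ofPair_e₁ (e e' : D.Edge) (h : e'.src = e.tgt) : (ofPair e e' h).e₁ = e := rfl

lemma ofPair_e₂' (e e' : D.Edge) (h : e'.src = e.tgt) : (ofPair e e' h).e₂' = e' :=
  Subtype.ext (Prod.ext h.symm rfl)

lemma src_e₁' (f : D.Face) : f.e₁'.src = f.e₂.tgt := rfl

lemma update_mid₂ (f : D.Face) : Function.update f.mid₂ f.x₁ true = f.last :=
  Function.update_comm f.ne.symm _ _ _

lemma tgt_e₁' (f : D.Face) : f.e₁'.tgt = f.last := f.update_mid₂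

end Face

/-- Composable pairs of edges cancel in twos: the partner of a pair changes the same two crossings
in the other order. -/
lemma sum_comp_sum_eq_zero {M : Type*} [AddCommGroup M] (G : D.Edge → M →ₗ[ℤ] M)
    (hG : ∀ e e' : D.Edge, e'.src ≠ e.tgt → G e' ∘ₗ G e = 0)
    (hface : ∀ f : D.Face, G f.e₂' ∘ₗ G f.e₁ + G f.e₁' ∘ₗ G f.e₂ = 0) :
    (∑ e, G e) ∘ₗ (∑ e, G e) = 0 := by
  classical
  have h₁ : (∑ e, G e) ∘ₗ (∑ e, G e) = ∑ p : D.Edge × D.Edge, G p.2 ∘ₗ G p.1 := by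
    ext x
    simp only [LinearMap.comp_apply, LinearMap.sum_apply, map_sum, Fintype.sum_prod_type]
  rw [h₁, ← Finset.sum_filter_add_sum_filter_not _ fun p : D.Edge × D.Edge => p.2.src = p.1.tgt,
    Finset.sum_eq_zero (s := Finset.univ.filter fun p : D.Edge × D.Edge => ¬ p.2.src = p.1.tgt)
      fun p hp => hG _ _ (Finset.mem_filter.1 hp).2, add_zero]
  have hp {p : D.Edge × D.Edge}
      (h : p ∈ Finset.univ.filter fun p : D.Edge × D.Edge => p.2.src = p.1.tgt) :
      p.2.src = p.1.tgt := (Finset.mem_filter.1 h).2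
  refine Finset.sum_involution
    (fun p h => ((Face.ofPair p.1 p.2 (hp h)).e₂, (Face.ofPair p.1 p.2 (hp h)).e₁')) ?_ ?_ ?_ ?_
  · intro p h
    have := hface (Face.ofPair p.1 p.2 (hp h))
    rwa [Face.ofPair_e₁, Face.ofPair_e₂'] at this
  · intro p h _ he
    have := congrArg (fun q : D.Edge × D.Edge => q.1.crossing) he
    exact (Face.ofPair p.1 p.2 (hp h)).ne this.symm
  · intro p h
    exact Finset.mem_filter.2 ⟨Finset.mem_univ _, Face.src_e₁' _⟩
  · intro p h
    refine Prod.ext rfl ?_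
    exact Face.ofPair_e₂' p.1 p.2 (hp h)

end LinkDiagram
end OddKhovanov
end

noncomputable section
namespace OddKhovanov

namespace LinkDiagram

variable {D : LinkDiagram}

/-! ### The odd complex in terms of products of circles -/

/-- The generator of `Λ^* V(D(I))` given by a circle. -/
def circleι (I : D.Vertex) (q : D.Circle I) : D.Lam I :=
  ExteriorAlgebra.ι ℤ (Finsupp.single q 1)

/-- The exterior product of the circles through the members of a list. -/
def oddProd (I : D.Vertex) (l : List D.Gen) : D.Lam I :=
  (l.map fun x => circleι I (cir I x)).prod

@[simp] lemma oddProd_nil (I : D.Vertex) : oddProd I [] = 1 := rfl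

@[simp] lemma oddProd_cons (I : D.Vertex) (x : D.Gen) (l : List D.Gen) :
    oddProd I (x :: l) = circleι I (cir I x) * oddProd I l := by
  simp [oddProd]

lemma isProductFamily_oddProd : IsProductFamily (D := D) (-1) (E := D.Lam) oddProd where
  swap I x y l := by
    rw [oddProd_cons, oddProd_cons, oddProd_cons, oddProd_cons, ← mul_assoc, ← mul_assoc, neg_smul,
      one_smul, ← neg_mul]
    congr 1
    exact eq_neg_of_add_eq_zero_left (ExteriorAlgebra.ι_add_mul_swap _ _)
  congr I x y l h := by rw [oddProd_cons, oddProd_cons, h]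

lemma span_oddProd (I : D.Vertex) : Submodule.span ℤ (Set.range (oddProd I)) = ⊤ := by
  rw [Submodule.eq_top_iff']
  intro x
  induction x using ExteriorAlgebra.induction with
  | algebraMap r =>
    rw [Algebra.algebraMap_eq_smul_one]
    exact Submodule.smul_mem _ _ (Submodule.subset_span ⟨[], rfl⟩)
  | ι m =>
    induction m using Finsupp.induction_linear with
    | zero => simp
    | add f g hf hg => rw [map_add]; exact Submodule.add_mem _ hf hg
    | single q r =>
      obtain ⟨x, rfl⟩ := cir_surjective I q
      have : (Finsupp.single (cir I x) r : D.V I) = r • Finsupp.single (cir I x) 1 := by simp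
      rw [this, map_smul]
      exact Submodule.smul_mem _ _ (Submodule.subset_span ⟨[x], by simp [circleι]⟩)
  | mul a b ha hb =>
    have := Submodule.mul_mem_mul ha hb
    rw [Submodule.span_mul_span] at this
    refine Submodule.span_mono ?_ this
    rintro _ ⟨_, ⟨l, rfl⟩, _, ⟨l', rfl⟩, rfl⟩
    exact ⟨l ++ l', by simp [oddProd]⟩
  | add a b ha hb => exact Submodule.add_mem _ ha hb

/-- `D.carry` uses a chosen representative, which may be a different dart of the same circle of `I`,
so its value need not be the circle of `J` through `x`. -/
lemma exists_carry_eq (I J : D.Vertex) (x : D.Gen) :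
    ∃ y, cir I y = cir I x ∧ D.carry I J (cir I x) = cir J y := by
  rcases x with d | l
  · refine ⟨Sum.inl (Quot.mk (fun d e : Dart D.n => e = D.opp d ∨ e = D.smooth I d) d).out, ?_, rfl⟩
    exact congrArg Sum.inl (Quot.out_eq _)
  · exact ⟨Sum.inr l, rfl, rfl⟩

lemma carryMap_oddProd (I J : D.Vertex) (l : List D.Gen) :
    D.carryMap I J (oddProd I l) = (l.map fun x => circleι J (D.carry I J (cir I x))).prod := by
  induction l with
  | nil => simp [carryMap]
  | cons x l ih =>
    simp only [carryMap, AlgHom.toLinearMap_apply, oddProd_cons, map_mul, List.map_cons,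
      List.prod_cons] at ih ⊢
    rw [ih]
    simp [circleι]

/-- The sign by which the arrow at a crossing enters the map of a split. -/
def arrowSign (o : D.Arrows) (c : Fin D.n) : ℤ := if o c = true then 1 else -1

lemma arrowSign_mul_self (o : D.Arrows) (c : Fin D.n) : arrowSign o c * arrowSign o c = 1 := by
  unfold arrowSign; split_ifs <;> rfl

lemma ι_splitElt (o : D.Arrows) (J : D.Vertex) (c : Fin D.n) :
    ExteriorAlgebra.ι ℤ (D.splitElt o J c) =
      arrowSign o c • (circleι J (D.circ J (c, 1)) - circleι J (D.circ J (c, 3))) := by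
  unfold splitElt arrowSign circleι
  split_ifs <;> simp

lemma sub_mul_circleι_comm (J : D.Vertex) (p q r : D.Circle J) :
    (circleι J p - circleι J q) * circleι J r = -(circleι J r * (circleι J p - circleι J q)) := by
  unfold circleι
  rw [← map_sub]
  exact eq_neg_of_add_eq_zero_left (ExteriorAlgebra.ι_add_mul_swap _ _)

/-- The square of p - q is zero. This makes the map of a split independent of the choice of lift. -/
lemma sub_mul_circleι_eq (J : D.Vertex) (p q : D.Circle J) :
    (circleι J p - circleι J q) * circleι J p = (circleι J p - circleι J q) * circleι J q := by
  rw [← sub_eq_zero, ← mul_sub]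
  unfold circleι
  rw [← map_sub]
  exact ExteriorAlgebra.ι_sq_zero _

/-- The representatives chosen by `carry` do not matter: for a merge each circle of `I` lies in one
circle of `J`, and for a split two choices differ by a multiple of the factor a₁ - a₂. -/
lemma isHandleMap_oddMap (o : D.Arrows) {I J : D.Vertex} {c : Fin D.n} (h : IsFlip I J c) :
    IsHandleMap (E := D.Lam) (-1) (arrowSign o) oddProd I J c (D.oddMap o I J c) where
  merge hI l := by
    rw [oddMap, if_neg hI, carryMap_oddProd, oddProd]
    congr 1
    refine List.map_congr_left fun x _ => ?_
    obtain ⟨y, hy, hy'⟩ := exists_carry_eq I J x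
    rw [hy', (h.isMerge hI).le hy]
  split hI l := by
    rw [oddMap, if_pos hI, LinearMap.comp_apply, LinearMap.mulLeft_apply, carryMap_oddProd,
      ι_splitElt, smul_mul_assoc, oddProd_cons, oddProd_cons, cir_inl, cir_inl, neg_smul,
      one_smul, ← sub_eq_add_neg, ← sub_mul]
    congr 1
    induction l with
    | nil => rfl
    | cons x l ih =>
      rw [List.map_cons, List.prod_cons, oddProd_cons, ← mul_assoc, ← mul_assoc]
      have key : (circleι J (D.circ J (c, 1)) - circleι J (D.circ J (c, 3))) *
            circleι J (D.carry I J (cir I x)) =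
          (circleι J (D.circ J (c, 1)) - circleι J (D.circ J (c, 3))) * circleι J (cir J x) := by
        obtain ⟨y, hy, hy'⟩ := exists_carry_eq I J x
        rw [hy']
        rcases ((h.isMerge_symm hI).eq_iff _ _).1 hy with h | ⟨h1, h2⟩ | ⟨h1, h2⟩
        · rw [h]
        · rw [h1, h2]; exact sub_mul_circleι_eq _ _ _
        · rw [h1, h2]; exact (sub_mul_circleι_eq _ _ _).symm
      rw [key, sub_mul_circleι_comm, neg_mul, neg_mul, mul_assoc, mul_assoc, ih]

/-! ### Signs around the faces of the odd hypercube -/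

namespace Face

variable (f : D.Face)

lemma isFlip₁ : IsFlip f.src f.mid₁ f.x₁ := isFlip_update f.h₁

lemma isFlip₂ : IsFlip f.src f.mid₂ f.x₂ := isFlip_update f.h₂

lemma isFlip₂' : IsFlip f.mid₁ f.last f.x₂ := isFlip_update f.e₂'.2

lemma isFlip₁' : IsFlip f.mid₂ f.last f.x₁ := by
  rw [← f.update_mid₂]
  exact isFlip_update f.e₁'.2

lemma comp₁₂_eq_or (o : D.Arrows) :
    f.comp₁₂ o = f.comp₂₁ o ∨ f.comp₁₂ o = -f.comp₂₁ o := by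
  obtain ⟨κ, hκ, h⟩ := exists_comp_eq_smul (E := D.Lam) isProductFamily_oddProd rfl
    (arrowSign_mul_self o) f.isFlip₁ f.isFlip₂ f.isFlip₁' f.isFlip₂'
    (isHandleMap_oddMap o f.isFlip₁) (isHandleMap_oddMap o f.isFlip₂)
    (isHandleMap_oddMap o f.isFlip₁') (isHandleMap_oddMap o f.isFlip₂')
  have hcomp : f.comp₁₂ o = κ • f.comp₂₁ o :=
    LinearMap.ext_on_range (span_oddProd f.src) h
  have hκ' : κ = 1 ∨ κ = -1 := by
    unfold arrowSign at hκ
    split_ifs at hκ <;> omega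
  rcases hκ' with rfl | rfl
  · exact Or.inl (by rw [hcomp, one_smul])
  · exact Or.inr (by rw [hcomp, neg_smul, one_smul])

/-- An edge assignment makes the two composites cancel. -/
lemma sign_comp_add (o : D.Arrows) (ε : D.Edge → ℤˣ)
    (hε : D.IsTypeXAssignment o ε ∨ D.IsTypeYAssignment o ε) :
    ((ε f.e₂' : ℤ) * (ε f.e₁ : ℤ)) • f.comp₁₂ o + ((ε f.e₁' : ℤ) * (ε f.e₂ : ℤ)) • f.comp₂₁ o =
      0 := by
  have hA : f.IsTypeA o → f.sign ε = 1 := fun h => hε.elim (fun h' => (h' f).1 (Or.inl h))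
    fun h' => (h' f).1 (Or.inl h)
  have hC : f.IsTypeC o → f.sign ε = -1 := fun h => hε.elim (fun h' => (h' f).2 (Or.inl h))
    fun h' => (h' f).2 (Or.inl h)
  -- If one composite vanishes so does the other, and no condition on signs is needed. Otherwise the
  -- face is of type A or C, where edge assignments of types X and Y obey the same rule.
  by_cases h0 : f.comp₁₂ o = 0
  · have : f.comp₂₁ o = 0 := by
      rcases f.comp₁₂_eq_or o with h | h
      · rw [← h, h0]
      · rwa [h, neg_eq_zero] at h0
    rw [h0, this, smul_zero, smul_zero, add_zero]
  · rcases f.comp₁₂_eq_or o with h | h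
    · have hs := hC ⟨h0, h⟩
      rw [h, ← add_smul]
      have : (ε f.e₂' : ℤ) * (ε f.e₁ : ℤ) + (ε f.e₁' : ℤ) * (ε f.e₂ : ℤ) = 0 := by
        unfold sign at hs
        rcases Int.units_eq_one_or (ε f.e₁) with h1 | h1 <;>
        rcases Int.units_eq_one_or (ε f.e₂) with h2 | h2 <;>
        rcases Int.units_eq_one_or (ε f.e₁') with h3 | h3 <;>
        rcases Int.units_eq_one_or (ε f.e₂') with h4 | h4 <;>
        rw [h1, h2, h3, h4] at hs ⊢ <;> revert hs <;> decide
      rw [this, zero_smul]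
    · have hs := hA ⟨h0, h⟩
      rw [h, smul_neg, neg_add_eq_sub, ← sub_smul]
      have : (ε f.e₁' : ℤ) * (ε f.e₂ : ℤ) - (ε f.e₂' : ℤ) * (ε f.e₁ : ℤ) = 0 := by
        unfold sign at hs
        rcases Int.units_eq_one_or (ε f.e₁) with h1 | h1 <;>
        rcases Int.units_eq_one_or (ε f.e₂) with h2 | h2 <;>
        rcases Int.units_eq_one_or (ε f.e₁') with h3 | h3 <;>
        rcases Int.units_eq_one_or (ε f.e₂') with h4 | h4 <;>
        rw [h1, h2, h3, h4] at hs ⊢ <;> revert hs <;> decide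
      rw [this, zero_smul]

end Face

/-- The map of an edge of the hypercube, on the odd complex. -/
def oddEdge (o : D.Arrows) (e : D.Edge) : D.OddChain →ₗ[ℤ] D.OddChain :=
  DirectSum.lof ℤ D.Vertex D.Lam e.tgt ∘ₗ D.oddMap o e.src e.tgt e.crossing ∘ₗ
    DirectSum.component ℤ D.Vertex D.Lam e.src

lemma oddDiff_eq (o : D.Arrows) (ε : D.Edge → ℤˣ) :
    D.oddDiff o ε = ∑ e : D.Edge, (ε e : ℤ) • oddEdge o e := rfl

lemma oddEdge_lof (o : D.Arrows) (e : D.Edge) (x : D.Lam e.src) :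
    oddEdge o e (DirectSum.lof ℤ D.Vertex D.Lam e.src x) =
      DirectSum.lof ℤ D.Vertex D.Lam e.tgt (D.oddMap o e.src e.tgt e.crossing x) := by
  rw [oddEdge, LinearMap.comp_apply, LinearMap.comp_apply, DirectSum.component.lof_self]

lemma oddEdge_lof_of_ne (o : D.Arrows) (e : D.Edge) {I : D.Vertex} (hI : I ≠ e.src)
    (x : D.Lam I) : oddEdge o e (DirectSum.lof ℤ D.Vertex D.Lam I x) = 0 := by
  rw [oddEdge, LinearMap.comp_apply, LinearMap.comp_apply, DirectSum.component.of, dif_neg hI,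
    map_zero, map_zero]

/-- The last corner of a face arises by two updates in either order; the resulting vertices are
equal but not by definition, and the groups depend on them. -/
lemma lof_oddMap_congr (o : D.Arrows) {I J J' : D.Vertex} (c : Fin D.n) (h : J = J')
    (x : D.Lam I) : DirectSum.lof ℤ D.Vertex D.Lam J (D.oddMap o I J c x) =
      DirectSum.lof ℤ D.Vertex D.Lam J' (D.oddMap o I J' c x) := by
  subst h; rfl

lemma oddDiff_comp_self (o : D.Arrows) (ε : D.Edge → ℤˣ)
    (hε : D.IsTypeXAssignment o ε ∨ D.IsTypeYAssignment o ε) :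
    D.oddDiff o ε ∘ₗ D.oddDiff o ε = 0 := by
  rw [oddDiff_eq]
  refine sum_comp_sum_eq_zero _ (fun e e' he => ?_) fun f => ?_
  · refine LinearMap.ext fun x => ?_
    simp only [LinearMap.comp_apply, LinearMap.smul_apply, map_smul]
    have : oddEdge o e' (oddEdge o e x) = 0 := oddEdge_lof_of_ne o e' he.symm _
    rw [this, smul_zero, smul_zero, LinearMap.zero_apply]
  · refine DirectSum.linearMap_ext ℤ fun I => LinearMap.ext fun x => ?_
    simp only [LinearMap.comp_apply, LinearMap.add_apply, LinearMap.smul_apply, map_smul,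
      LinearMap.zero_apply]
    by_cases hI : I = f.src
    · subst hI
      have h₁ : oddEdge o f.e₂' (oddEdge o f.e₁ (DirectSum.lof ℤ D.Vertex D.Lam f.src x)) =
          DirectSum.lof ℤ D.Vertex D.Lam f.last (f.comp₁₂ o x) := by
        have := oddEdge_lof o f.e₁ x
        refine (congrArg (oddEdge o f.e₂') this).trans ?_
        exact oddEdge_lof o f.e₂' _
      have h₂ : oddEdge o f.e₁' (oddEdge o f.e₂ (DirectSum.lof ℤ D.Vertex D.Lam f.src x)) =
          DirectSum.lof ℤ D.Vertex D.Lam f.last (f.comp₂₁ o x) := by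
        have := oddEdge_lof o f.e₂ x
        refine (congrArg (oddEdge o f.e₁') this).trans ?_
        refine (oddEdge_lof o f.e₁' _).trans ?_
        exact lof_oddMap_congr o _ f.tgt_e₁' _
      have h := LinearMap.congr_fun (f.sign_comp_add o ε hε) x
      rw [LinearMap.add_apply, LinearMap.smul_apply, LinearMap.smul_apply] at h
      have h' := congrArg (DirectSum.lof ℤ D.Vertex D.Lam f.last) h
      rw [map_add, map_smul, map_smul, LinearMap.zero_apply, map_zero] at h'
      rw [h₁, h₂, smul_smul, smul_smul, mul_comm, mul_comm (ε f.e₂ : ℤ)]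
      exact h'
    · rw [oddEdge_lof_of_ne o f.e₁ hI, oddEdge_lof_of_ne o f.e₂ hI]
      simp

end LinkDiagram
end OddKhovanov
end

noncomputable section
namespace OddKhovanov

namespace LinkDiagram

variable {D : LinkDiagram}

/-! ### Khovanov's complex in terms of products of circles -/

lemma Label_eq_iff {x y : Label} : x = y ↔ (x = .minus ↔ y = .minus) := by
  cases x <;> cases y <;> simp

lemma mulRel_iff {x y z : Label} :
    MulRel x y z ↔ ¬ (x = .minus ∧ y = .minus) ∧ (z = .minus ↔ x = .minus ∨ y = .minus) := by
  constructor
  · rintro (_ | _ | _) <;> simp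
  · cases x <;> cases y <;> cases z <;> simp <;> constructor

lemma comulRel_iff {x y z : Label} :
    ComulRel x y z ↔ (x = .minus ∧ y = .minus ∧ z = .minus) ∨
      (x ≠ .minus ∧ y = .minus ∧ z ≠ .minus) ∨ (x ≠ .minus ∧ y ≠ .minus ∧ z = .minus) := by
  constructor
  · rintro (_ | _ | _) <;> simp
  · cases x <;> cases y <;> cases z <;> simp <;> constructor

open Classical in
/-- The state with label `v₋` on the circles through the members of a list, and label `v₊` on the
others. -/
def stateOf (I : D.Vertex) (l : List D.Gen) : D.State I :=
  fun q => if q ∈ l.map (cir I) then .minus else .plus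

lemma stateOf_eq_minus {I : D.Vertex} {l : List D.Gen} {q : D.Circle I} :
    stateOf I l q = .minus ↔ q ∈ l.map (cir I) := by
  unfold stateOf; split_ifs with h <;> simp [h]

open Classical in
/-- The product of the circles through the members of a list, where circles have square zero. -/
def evenProd (I : D.Vertex) (l : List D.Gen) : D.EvenChain :=
  if (l.map (cir I)).Nodup then Finsupp.single ⟨I, stateOf I l⟩ 1 else 0

lemma evenProd_of_perm {I : D.Vertex} {l l' : List D.Gen}
    (h : (l.map (cir I)).Perm (l'.map (cir I))) : evenProd I l = evenProd I l' := by
  have hs : stateOf I l = stateOf I l' := by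
    funext q; rw [Label_eq_iff, stateOf_eq_minus, stateOf_eq_minus, h.mem_iff]
  unfold evenProd
  rw [hs]
  by_cases hn : (l.map (cir I)).Nodup
  · rw [if_pos hn, if_pos (h.nodup_iff.1 hn)]
  · rw [if_neg hn, if_neg (mt h.nodup_iff.2 hn)]

lemma isProductFamily_evenProd :
    IsProductFamily (D := D) 1 (E := fun _ => D.EvenChain) evenProd where
  swap I x y l := by
    rw [one_smul]
    exact evenProd_of_perm (List.Perm.swap _ _ _)
  congr I x y l h := evenProd_of_perm (by rw [List.map_cons, List.map_cons, h])

/-- Every state is given by a list of generators. -/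
lemma exists_stateOf_eq {I : D.Vertex} (σ : D.State I) :
    ∃ l : List D.Gen, (l.map (cir I)).Nodup ∧ stateOf I l = σ := by
  classical
  have hs : Function.RightInverse (Function.surjInv (cir_surjective I)) (cir I) :=
    Function.rightInverse_surjInv _
  refine ⟨((Finset.univ.filter fun q => σ q = .minus).toList).map
    (Function.surjInv (cir_surjective I)), ?_, ?_⟩
  · rw [List.map_map, hs.comp_eq_id, List.map_id]
    exact Finset.nodup_toList _
  · funext q
    rw [Label_eq_iff, stateOf_eq_minus, List.map_map, hs.comp_eq_id, List.map_id]
    simp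

/-! ### States under merging and splitting of circles -/

namespace IsMerge

variable {I J : D.Vertex} {a b : D.Gen}

/-- The only new coincidence in `J` is between the circles of `a` and `b`; a product dies under the
merge exactly when it contains both, which is v₋ v₋ = 0. -/
lemma nodup_iff (h : IsMerge I J a b) (l : List D.Gen) : (l.map (cir J)).Nodup ↔
    (l.map (cir I)).Nodup ∧ ¬ (cir I a ∈ l.map (cir I) ∧ cir I b ∈ l.map (cir I)) := by
  constructor
  · intro hn
    have hinj := List.inj_on_of_nodup_map hn
    refine ⟨(List.Nodup.of_map _ hn).map_on fun x hx y hy hxy => hinj hx hy (h.le hxy), ?_⟩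
    rintro ⟨ha, hb⟩
    obtain ⟨x, hx, hxa⟩ := List.mem_map.1 ha
    obtain ⟨y, hy, hyb⟩ := List.mem_map.1 hb
    have := hinj hx hy ((h.le hxa).trans (h.eq.trans (h.le hyb).symm))
    exact h.ne (by rw [← hxa, ← hyb, this])
  · rintro ⟨hn, hab⟩
    have hinj := List.inj_on_of_nodup_map hn
    refine (List.Nodup.of_map _ hn).map_on fun x hx y hy hxy => ?_
    rcases (h.eq_iff x y).1 hxy with e | ⟨e1, e2⟩ | ⟨e1, e2⟩
    · exact hinj hx hy e
    · exact absurd ⟨e1 ▸ List.mem_map_of_mem hx, e2 ▸ List.mem_map_of_mem hy⟩ hab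
    · exact absurd ⟨e2 ▸ List.mem_map_of_mem hy, e1 ▸ List.mem_map_of_mem hx⟩ hab

lemma mem_iff_of_ne (h : IsMerge I J a b) (l : List D.Gen) {x : D.Gen} (ha : cir I x ≠ cir I a)
    (hb : cir I x ≠ cir I b) : cir J x ∈ l.map (cir J) ↔ cir I x ∈ l.map (cir I) := by
  simp only [List.mem_map, h.eq_iff, ha, hb, and_false, or_false]

lemma mem_iff (h : IsMerge I J a b) (l : List D.Gen) :
    cir J a ∈ l.map (cir J) ↔ cir I a ∈ l.map (cir I) ∨ cir I b ∈ l.map (cir I) := by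
  have hne := h.ne
  simp only [List.mem_map, h.eq_iff, hne, and_false, and_true, false_or]
  constructor
  · rintro ⟨y, hy, e | e⟩
    · exact Or.inl ⟨y, hy, e⟩
    · exact Or.inr ⟨y, hy, e⟩
  · rintro (⟨y, hy, e⟩ | ⟨y, hy, e⟩)
    · exact ⟨y, hy, Or.inl e⟩
    · exact ⟨y, hy, Or.inr e⟩

/-- Two states of `J` are equal if they agree on the merged circle and on the other circles. -/
lemma state_ext (h : IsMerge I J a b) {σ τ : D.State J} (hab : σ (cir J a) = τ (cir J a))
    (hx : ∀ x, cir I x ≠ cir I a → cir I x ≠ cir I b → σ (cir J x) = τ (cir J x)) : σ = τ := by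
  funext q
  obtain ⟨x, rfl⟩ := cir_surjective J q
  by_cases ha : cir I x = cir I a
  · rwa [h.le ha]
  by_cases hb : cir I x = cir I b
  · rwa [h.le hb, ← h.eq]
  exact hx x ha hb

/-- Multiplication in A sets the variables of `a` and `b` equal, so it keeps the list; the result is
zero if a circle is now repeated. -/
lemma mulRel_stateOf_iff (h : IsMerge I J a b) {l : List D.Gen} (hl : (l.map (cir I)).Nodup)
    (τ : D.State J) :
    ((∀ x, cir I x ≠ cir I a → cir I x ≠ cir I b → τ (cir J x) = stateOf I l (cir I x)) ∧
      MulRel (stateOf I l (cir I a)) (stateOf I l (cir I b)) (τ (cir J a))) ↔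
    (l.map (cir J)).Nodup ∧ τ = stateOf J l := by
  have hout {x : D.Gen} (ha : cir I x ≠ cir I a) (hb : cir I x ≠ cir I b) :
      stateOf J l (cir J x) = stateOf I l (cir I x) := by
    rw [Label_eq_iff, stateOf_eq_minus, stateOf_eq_minus, h.mem_iff_of_ne l ha hb]
  rw [mulRel_iff, stateOf_eq_minus, stateOf_eq_minus, h.nodup_iff, ← h.mem_iff]
  constructor
  · rintro ⟨h1, h2, h3⟩
    refine ⟨⟨hl, h2⟩, h.state_ext ?_ fun x ha hb => ?_⟩
    · rw [Label_eq_iff, h3, stateOf_eq_minus]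
    · rw [h1 x ha hb, hout ha hb]
  · rintro ⟨⟨-, h2⟩, rfl⟩
    exact ⟨fun x ha hb => hout ha hb, h2, stateOf_eq_minus⟩

/-- Comultiplication in A multiplies a lift by a + b. If the circle being split is labelled v₋, then
`l` already contains one of the two new circles, one of the summands has a repetition, and the other
is v₋ ⊗ v₋. -/
lemma comulRel_stateOf_iff (h : IsMerge I J a b) {l : List D.Gen} (hl : (l.map (cir J)).Nodup)
    (τ : D.State I) :
    ((∀ x, cir I x ≠ cir I a → cir I x ≠ cir I b → τ (cir I x) = stateOf J l (cir J x)) ∧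
      ComulRel (stateOf J l (cir J a)) (τ (cir I a)) (τ (cir I b))) ↔
    (((a :: l).map (cir I)).Nodup ∧ τ = stateOf I (a :: l)) ∨
      (((b :: l).map (cir I)).Nodup ∧ τ = stateOf I (b :: l)) := by
  have hne := h.ne
  obtain ⟨hI, hab⟩ := (h.nodup_iff l).1 hl
  have hout {x : D.Gen} (ha : cir I x ≠ cir I a) (hb : cir I x ≠ cir I b) :
      stateOf J l (cir J x) = .minus ↔ cir I x ∈ l.map (cir I) := by
    rw [stateOf_eq_minus, h.mem_iff_of_ne l ha hb]
  have hstate (c : D.Gen) : τ = stateOf I (c :: l) ↔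
      ∀ x, τ (cir I x) = .minus ↔ cir I x = cir I c ∨ cir I x ∈ l.map (cir I) := by
    constructor
    · rintro rfl x
      rw [stateOf_eq_minus, List.map_cons, List.mem_cons]
    · intro hx
      funext q
      obtain ⟨x, rfl⟩ := cir_surjective I q
      rw [Label_eq_iff, hx, stateOf_eq_minus, List.map_cons, List.mem_cons]
  rw [comulRel_iff, hstate, hstate, stateOf_eq_minus, Ne, stateOf_eq_minus, h.mem_iff,
    List.map_cons, List.map_cons, List.nodup_cons, List.nodup_cons]
  constructor
  · rintro ⟨h1, h2⟩
    have h1' (x) (ha : cir I x ≠ cir I a) (hb : cir I x ≠ cir I b) :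
        τ (cir I x) = .minus ↔ cir I x ∈ l.map (cir I) := by rw [h1 x ha hb, hout ha hb]
    -- Away from the two new circles the labels are prescribed, so a description of `τ` has to be
    -- verified at `a` and `b` only.
    have hall (P : D.Circle I → Prop) (ha : τ (cir I a) = .minus ↔ P (cir I a))
        (hb : τ (cir I b) = .minus ↔ P (cir I b))
        (hP : ∀ x, cir I x ≠ cir I a → cir I x ≠ cir I b → (P (cir I x) ↔ cir I x ∈ l.map (cir I)))
        (x : D.Gen) : τ (cir I x) = .minus ↔ P (cir I x) := by
      by_cases hxa : cir I x = cir I a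
      · rwa [hxa]
      by_cases hxb : cir I x = cir I b
      · rwa [hxb]
      rw [h1' x hxa hxb, hP x hxa hxb]
    have hA := hall fun q => q = cir I a ∨ q ∈ l.map (cir I)
    have hB := hall fun q => q = cir I b ∨ q ∈ l.map (cir I)
    rcases h2 with ⟨h2, h3, h4⟩ | ⟨h2, h3, h4⟩ | ⟨h2, h3, h4⟩
    · rcases h2 with ma | mb
      · have mb : cir I b ∉ l.map (cir I) := fun mb => hab ⟨ma, mb⟩
        exact Or.inr ⟨⟨mb, hI⟩, hB (by simp only [h3, ma, or_true])
          (by simp only [h4, true_or]) fun x _ hb => by simp only [hb, false_or]⟩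
      · have ma : cir I a ∉ l.map (cir I) := fun ma => hab ⟨ma, mb⟩
        exact Or.inl ⟨⟨ma, hI⟩, hA (by simp only [h3, true_or])
          (by simp only [h4, mb, or_true]) fun x ha _ => by simp only [ha, false_or]⟩
    · obtain ⟨ma, mb⟩ := not_or.1 h2
      exact Or.inl ⟨⟨ma, hI⟩, hA (by simp only [h3, true_or])
        (by simp only [h4, mb, hne.symm, or_false]) fun x ha _ => by simp only [ha, false_or]⟩
    · obtain ⟨ma, mb⟩ := not_or.1 h2
      exact Or.inr ⟨⟨mb, hI⟩, hB (by simp only [h3, ma, hne, or_false])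
        (by simp only [h4, true_or]) fun x _ hb => by simp only [hb, false_or]⟩
  · have hL {x : D.Gen} (ha : cir I x ≠ cir I a) (hb : cir I x ≠ cir I b)
        (hx : τ (cir I x) = .minus ↔ cir I x ∈ l.map (cir I)) :
        τ (cir I x) = stateOf J l (cir J x) := by rw [Label_eq_iff, hx, hout ha hb]
    rintro (⟨⟨ma, -⟩, h2⟩ | ⟨⟨mb, -⟩, h2⟩)
    · refine ⟨fun x ha hb => hL ha hb (by rw [h2]; simp only [ha, false_or]), ?_⟩
      have e1 : τ (cir I a) = .minus := (h2 a).2 (Or.inl rfl)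
      have e2 := h2 b
      simp only [hne.symm, false_or] at e2
      by_cases mb : cir I b ∈ l.map (cir I)
      · exact Or.inl ⟨Or.inr mb, e1, e2.2 mb⟩
      · exact Or.inr (Or.inl ⟨not_or.2 ⟨ma, mb⟩, e1, fun h => mb (e2.1 h)⟩)
    · refine ⟨fun x ha hb => hL ha hb (by rw [h2]; simp only [hb, false_or]), ?_⟩
      have e1 : τ (cir I b) = .minus := (h2 b).2 (Or.inl rfl)
      have e2 := h2 a
      simp only [hne, false_or] at e2
      by_cases ma : cir I a ∈ l.map (cir I)
      · exact Or.inl ⟨Or.inl ma, e2.2 ma, e1⟩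
      · exact Or.inr (Or.inr ⟨not_or.2 ⟨ma, mb⟩, fun h => ma (e2.1 h), e1⟩)

end IsMerge

/-- Generators treat circles through crossings and loops uniformly, which brings `Occurs` into the
form used in `mulRel_stateOf_iff`. -/
lemma occurs_iff_of_ne {I J : D.Vertex} {c : Fin D.n} (h : IsFlip I J c)
    (hI : D.circ I (c, 0) ≠ D.circ I (c, 2)) (σ : D.State I) (τ : D.State J) :
    D.Occurs I J c σ τ ↔
      (∀ x, cir I x ≠ cir I (.inl (c, 0)) → cir I x ≠ cir I (.inl (c, 2)) →
        τ (cir J x) = σ (cir I x)) ∧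
      MulRel (σ (cir I (.inl (c, 0)))) (σ (cir I (.inl (c, 2)))) (τ (cir J (.inl (c, 0)))) := by
  have h1 : D.circ J (c, 1) = cir J (.inl (c, 0)) :=
    h.circ_tgt₂.symm.trans (h.isMerge hI).eq.symm
  unfold Occurs
  rw [h1]
  constructor
  · rintro ⟨hl, hd, hm, -⟩
    refine ⟨?_, hm hI⟩
    rintro (d | l) ha hb
    · exact hd d ha hb
    · exact hl l
  · rintro ⟨hx, hm⟩
    exact ⟨fun l => hx (.inr l) (by simp [circ]) (by simp [circ]), fun d => hx (.inl d),
      fun _ => hm, fun h => absurd h hI⟩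

lemma occurs_iff_of_eq {I J : D.Vertex} {c : Fin D.n} (h : IsFlip I J c)
    (hI : D.circ I (c, 0) = D.circ I (c, 2)) (σ : D.State I) (τ : D.State J) :
    D.Occurs I J c σ τ ↔
      (∀ x, cir J x ≠ cir J (.inl (c, 1)) → cir J x ≠ cir J (.inl (c, 3)) →
        τ (cir J x) = σ (cir I x)) ∧
      ComulRel (σ (cir I (.inl (c, 1)))) (τ (cir J (.inl (c, 1)))) (τ (cir J (.inl (c, 3)))) := by
  have hm := h.isMerge_symm hI
  have h1 : cir I (.inl (c, 1)) = D.circ I (c, 0) := h.circ_src₁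
  have h3 : cir I (.inl (c, 3)) = D.circ I (c, 0) := h.circ_src₃.trans hI.symm
  have hiff (x : D.Gen) : cir I x = D.circ I (c, 0) ↔
      cir J x = cir J (.inl (c, 1)) ∨ cir J x = cir J (.inl (c, 3)) := by
    rw [← h1, hm.eq_iff]
    have := hm.ne
    tauto
  unfold Occurs
  rw [h1, ← hI]
  constructor
  · rintro ⟨hl, hd, -, hc⟩
    refine ⟨?_, hc rfl⟩
    rintro (d | l) ha hb
    · have : D.circ I d ≠ D.circ I (c, 0) := fun e => ((hiff (.inl d)).1 e).elim ha hb
      exact hd d this this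
    · exact hl l
  · rintro ⟨hx, hc⟩
    refine ⟨fun l => hx (.inr l) (by simp [circ]) (by simp [circ]), fun d hd _ => ?_,
      fun h => absurd rfl h, fun _ => hc⟩
    exact hx (.inl d) (fun e => hd ((hiff (.inl d)).2 (Or.inl e)))
      fun e => hd ((hiff (.inl d)).2 (Or.inr e))

open Classical in
lemma evenMap_single (e : D.Edge) (σ : D.State e.src) :
    D.evenMap e (Finsupp.single ⟨e.src, σ⟩ 1) =
      ∑ T ∈ Finset.univ.filter (fun T : D.EnhancedState =>
        T.1 = e.tgt ∧ D.Occurs e.src T.1 e.crossing σ T.2), Finsupp.single T (1 : ℤ) := by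
  rw [evenMap, Finsupp.linearCombination_single, one_smul]
  simp only [true_and]

lemma evenMap_single_of_ne (e : D.Edge) {S : D.EnhancedState} (hS : S.1 ≠ e.src) :
    D.evenMap e (Finsupp.single S 1) = 0 := by
  rw [evenMap, Finsupp.linearCombination_single, one_smul]
  simp [hS]

lemma isFlip_edge (e : D.Edge) : IsFlip e.src e.tgt e.crossing := isFlip_update e.2

lemma isHandleMap_evenMap (e : D.Edge) :
    IsHandleMap (E := fun _ => D.EvenChain) 1 (fun _ => 1) evenProd e.src e.tgt e.crossing
      (D.evenMap e) where
  merge hI l := by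
    classical
    have hf := isFlip_edge e
    have hm := hf.isMerge hI
    unfold evenProd
    by_cases hl : (l.map (cir e.src)).Nodup
    · rw [if_pos hl, evenMap_single]
      have : (Finset.univ.filter (fun T : D.EnhancedState =>
          T.1 = e.tgt ∧ D.Occurs e.src T.1 e.crossing (stateOf e.src l) T.2)) =
          if (l.map (cir e.tgt)).Nodup then {⟨e.tgt, stateOf e.tgt l⟩} else ∅ := by
        ext ⟨K, τ⟩
        simp only [Finset.mem_filter, Finset.mem_univ, true_and]
        constructor
        · rintro ⟨rfl, h⟩
          obtain ⟨h1, rfl⟩ := (hm.mulRel_stateOf_iff hl τ).1 ((occurs_iff_of_ne hf hI _ _).1 h)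
          rw [if_pos h1]
          exact Finset.mem_singleton_self _
        · split_ifs with h1
          · intro h
            cases Finset.mem_singleton.1 h
            exact ⟨rfl, (occurs_iff_of_ne hf hI _ _).2 ((hm.mulRel_stateOf_iff hl _).2 ⟨h1, rfl⟩)⟩
          · simp
      rw [this]
      split_ifs <;> simp
    · rw [if_neg hl, if_neg fun h => hl ((hm.nodup_iff l).1 h).1, map_zero]
  split hI l := by
    classical
    have hf := isFlip_edge e
    have hm := hf.isMerge_symm hI
    rw [one_smul, one_smul]
    unfold evenProd
    by_cases hl : (l.map (cir e.src)).Nodup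
    · rw [if_pos hl, evenMap_single]
      have : (Finset.univ.filter (fun T : D.EnhancedState =>
          T.1 = e.tgt ∧ D.Occurs e.src T.1 e.crossing (stateOf e.src l) T.2)) =
          (if ((Sum.inl (e.crossing, 1) :: l).map (cir e.tgt)).Nodup then
              {⟨e.tgt, stateOf e.tgt (Sum.inl (e.crossing, 1) :: l)⟩} else ∅) ∪
            (if ((Sum.inl (e.crossing, 3) :: l).map (cir e.tgt)).Nodup then
              {⟨e.tgt, stateOf e.tgt (Sum.inl (e.crossing, 3) :: l)⟩} else ∅) := by
        ext ⟨K, τ⟩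
        simp only [Finset.mem_filter, Finset.mem_univ, true_and, Finset.mem_union]
        constructor
        · rintro ⟨rfl, h⟩
          rcases (hm.comulRel_stateOf_iff hl τ).1 ((occurs_iff_of_eq hf hI _ _).1 h) with
            ⟨h1, rfl⟩ | ⟨h1, rfl⟩
          · rw [if_pos h1]
            exact Or.inl (Finset.mem_singleton_self _)
          · rw [if_pos h1]
            exact Or.inr (Finset.mem_singleton_self _)
        · have key (τ) := fun h => (occurs_iff_of_eq hf hI (stateOf e.src l) τ).2
            ((hm.comulRel_stateOf_iff hl τ).2 h)
          rintro (h | h)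
          · split_ifs at h with h1
            · cases Finset.mem_singleton.1 h
              exact ⟨rfl, key _ (Or.inl ⟨h1, rfl⟩)⟩
            · simp at h
          · split_ifs at h with h1
            · cases Finset.mem_singleton.1 h
              exact ⟨rfl, key _ (Or.inr ⟨h1, rfl⟩)⟩
            · simp at h
      rw [this, Finset.sum_union]
      · split_ifs <;> simp
      · split_ifs with h1 h2
        -- The first state has v₋ on the circle of end 1. The second cannot: that circle differs
        -- from the one of end 3 and, by `h1`, is not in `l`.
        · refine Finset.disjoint_singleton.2 fun h => ?_
          have h' := eq_of_heq (Sigma.mk.inj h).2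
          have h3 : stateOf e.tgt (Sum.inl (e.crossing, 1) :: l)
              (cir e.tgt (Sum.inl (e.crossing, 1))) = .minus := stateOf_eq_minus.2 (by simp)
          rw [h', stateOf_eq_minus, List.map_cons, List.mem_cons] at h3
          rw [List.map_cons, List.nodup_cons] at h1
          exact h3.elim hm.ne h1.1
        · simp
        · simp
        · simp
    · rw [if_neg hl, map_zero]
      -- A repetition in the source persists in the target unless it came from the circle that is
      -- split. Then both new circles are in `l`, and a further factor repeats one of them.
      have hn : ∀ c, (c = Sum.inl (e.crossing, 1) ∨ c = Sum.inl (e.crossing, 3)) →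
          ¬ ((c :: l).map (cir e.tgt)).Nodup := by
        intro c hc h
        rw [List.map_cons, List.nodup_cons] at h
        refine hl ((hm.nodup_iff l).2 ⟨h.2, fun h' => h.1 ?_⟩)
        rcases hc with rfl | rfl
        · exact h'.1
        · exact h'.2
      rw [if_neg (hn _ (Or.inl rfl)), if_neg (hn _ (Or.inr rfl)), add_zero]

end LinkDiagram
end OddKhovanov
end

noncomputable section
namespace OddKhovanov

namespace LinkDiagram

variable {D : LinkDiagram}

/-! ### The even differential -/

open Classical in
lemma card_filter_update (I : D.Vertex) (P : Fin D.n → Prop) {x : Fin D.n} (hx : I x = false) :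
    (Finset.univ.filter fun y => P y ∧ Function.update I x true y = true).card =
      (Finset.univ.filter fun y => P y ∧ I y = true).card + if P x then 1 else 0 := by
  split_ifs with h
  · rw [← Finset.card_insert_of_notMem (a := x) (by simp [hx])]
    congr 1
    ext y
    by_cases hy : y = x <;> simp [hy, h]
  · rw [add_zero]
    congr 1
    ext y
    by_cases hy : y = x
    · subst hy; simp [h]
    · simp [hy]

/-- The new 1-resolution at `x` is counted in the sign at `c` exactly when `x` precedes `c`. On a
face this happens for just one of the two orders, so opposite edges contribute an odd number of sign
changes. -/
lemma evenSign_update (I : D.Vertex) {x c : Fin D.n} (hx : I x = false) (hc : I c = false)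
    (h : Function.update I x true c = false) :
    D.evenSign ⟨(Function.update I x true, c), h⟩ =
      D.evenSign ⟨(I, c), hc⟩ * if x < c then -1 else 1 := by
  unfold evenSign
  have := card_filter_update I (fun y => y < c) hx
  have h' : (Finset.univ.filter fun y => y < c ∧ Function.update I x true y = true).card =
      (Finset.univ.filter fun y => y < c ∧ I y = true).card + if x < c then 1 else 0 := by
    convert this
  refine (congrArg ((-1 : ℤ) ^ ·) h').trans ?_
  rw [pow_add]
  congr 1
  split_ifs <;> simp

lemma Face.evenSign_add (f : D.Face) :
    D.evenSign f.e₂' * D.evenSign f.e₁ + D.evenSign f.e₁' * D.evenSign f.e₂ = 0 := by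
  have h₂ : D.evenSign f.e₂' = D.evenSign f.e₂ * if f.x₁ < f.x₂ then -1 else 1 :=
    evenSign_update f.src f.h₁ f.h₂ _
  have h₁ : D.evenSign f.e₁' = D.evenSign f.e₁ * if f.x₂ < f.x₁ then -1 else 1 :=
    evenSign_update f.src f.h₂ f.h₁ _
  rw [h₁, h₂]
  rcases lt_or_gt_of_ne f.ne with h | h
  · rw [if_pos h, if_neg h.not_gt]; ring
  · rw [if_neg h.not_gt, if_pos h]; ring

lemma evenChain_hom_ext {M : Type*} [AddCommGroup M] {F G : D.EvenChain →ₗ[ℤ] M}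
    (h : ∀ I l, F (evenProd I l) = G (evenProd I l)) : F = G := by
  refine Finsupp.lhom_ext' fun ⟨I, σ⟩ => LinearMap.ext_ring ?_
  obtain ⟨l, hl, rfl⟩ := exists_stateOf_eq σ
  have := h I l
  rw [evenProd, if_pos hl] at this
  exact this

lemma evenMap_evenProd_of_ne (e : D.Edge) {I : D.Vertex} (hI : I ≠ e.src) (l : List D.Gen) :
    D.evenMap e (evenProd I l) = 0 := by
  unfold evenProd
  split_ifs
  · exact evenMap_single_of_ne e hI
  · rw [map_zero]

lemma evenDiff_comp_self : D.evenDiff ∘ₗ D.evenDiff = 0 := by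
  refine sum_comp_sum_eq_zero _ (fun e e' he => evenChain_hom_ext fun I l => ?_) fun f =>
    evenChain_hom_ext fun I l => ?_
  · simp only [LinearMap.comp_apply, LinearMap.smul_apply, map_smul, LinearMap.zero_apply]
    have key : D.evenMap e' (D.evenMap e (evenProd I l)) = 0 := by
      by_cases hI : I = e.src
      · subst hI
        by_cases h : D.circ e.src (e.crossing, 0) = D.circ e.src (e.crossing, 2)
        · rw [(isHandleMap_evenMap e).split h, map_smul, map_add, map_smul,
            evenMap_evenProd_of_ne e' he.symm, evenMap_evenProd_of_ne e' he.symm]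
          simp
        · rw [(isHandleMap_evenMap e).merge h, evenMap_evenProd_of_ne e' he.symm]
      · rw [evenMap_evenProd_of_ne e hI, map_zero]
    rw [key, smul_zero, smul_zero]
  · simp only [LinearMap.comp_apply, LinearMap.smul_apply, map_smul, LinearMap.zero_apply,
      LinearMap.add_apply]
    by_cases hI : I = f.src
    · subst hI
      have h₁' := isHandleMap_evenMap f.e₁'
      rw [f.tgt_e₁'] at h₁'
      obtain ⟨κ, hκ, h⟩ := exists_comp_eq_smul (E := fun _ => D.EvenChain)
        isProductFamily_evenProd rfl (fun _ => rfl) f.isFlip₁ f.isFlip₂ f.isFlip₁' f.isFlip₂'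
        (isHandleMap_evenMap f.e₁) (isHandleMap_evenMap f.e₂) h₁' (isHandleMap_evenMap f.e₂')
      -- With η = 1 and trivial arrow signs all four possible factors are 1, so every face commutes
      -- before Khovanov's signs are inserted.
      have hκ' : κ = 1 := by simpa using hκ
      rw [h, hκ', one_smul, smul_smul, smul_smul, ← add_smul, mul_comm, mul_comm (D.evenSign f.e₂),
        f.evenSign_add, zero_smul]
    · have h₁ := evenMap_evenProd_of_ne f.e₁ hI l
      have h₂ := evenMap_evenProd_of_ne f.e₂ hI l
      rw [h₁, h₂, map_zero, map_zero, smul_zero, smul_zero, smul_zero, smul_zero, add_zero]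

/-! ### The gradings -/

/-- The homological grading of the vertex `I`. -/
def mDeg (I : D.Vertex) : ℤ := (D.height I : ℤ) - D.nMinus

/-- The quantum grading of products of `r` circles at the vertex `I`. -/
def sDeg (I : D.Vertex) (r : ℕ) : ℤ :=
  ((Fintype.card (D.Circle I) : ℤ) - 2 * r) + D.nPlus - 2 * D.nMinus + D.height I

lemma IsFlip.height {I J : D.Vertex} {c : Fin D.n} (h : IsFlip I J c) :
    D.height J = D.height I + 1 := by
  have hJ : J = Function.update I c true := by
    funext x
    by_cases hx : x = c
    · subst hx; simp [h.tgt]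
    · simp [hx, h.of_ne x hx]
  have := card_filter_update I (fun _ => True) h.src
  simp only [true_and, if_true] at this
  rw [hJ]
  exact this

lemma IsFlip.mDeg {I J : D.Vertex} {c : Fin D.n} (h : IsFlip I J c) :
    mDeg J = mDeg I + 1 := by
  unfold LinkDiagram.mDeg
  rw [h.height]
  push_cast
  ring

/-- The loss of a circle is balanced by the additional 1-resolution. -/
lemma IsFlip.sDeg_of_ne {I J : D.Vertex} {c : Fin D.n} (h : IsFlip I J c)
    (hI : D.circ I (c, 0) ≠ D.circ I (c, 2)) (r : ℕ) : sDeg J r = sDeg I r := by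
  unfold sDeg
  rw [h.height, h.card_circle_of_ne hI]
  push_cast
  ring

/-- The new circle and the new 1-resolution contribute 2, which the extra factor of the product
takes away. -/
lemma IsFlip.sDeg_of_eq {I J : D.Vertex} {c : Fin D.n} (h : IsFlip I J c)
    (hI : D.circ I (c, 0) = D.circ I (c, 2)) (r : ℕ) : sDeg J (r + 1) = sDeg I r := by
  unfold sDeg
  rw [h.height, h.card_circle_of_eq hI]
  push_cast
  ring

lemma sum_deg_stateOf {I : D.Vertex} {l : List D.Gen} (hl : (l.map (cir I)).Nodup) :
    ∑ q, (stateOf I l q).deg = (Fintype.card (D.Circle I) : ℤ) - 2 * l.length := by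
  classical
  have h (q : D.Circle I) : (stateOf I l q).deg =
      1 - 2 * if q ∈ (l.map (cir I)).toFinset then 1 else 0 := by
    unfold stateOf
    by_cases hq : q ∈ l.map (cir I)
    · rw [if_pos hq, if_pos (List.mem_toFinset.2 hq)]; rfl
    · rw [if_neg hq, if_neg (mt List.mem_toFinset.1 hq)]; rfl
  simp only [h, Finset.sum_sub_distrib, ← Finset.mul_sum, Finset.sum_ite_mem, Finset.univ_inter,
    Finset.sum_const]
  rw [List.toFinset_card_of_nodup hl, List.length_map, Finset.card_univ]
  simp

/-- Lists with repeated circles are harmless, since their product is zero. The odd grading has the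
same description, which allows a comparison generator by generator. -/
lemma evenGrading_eq_span (m s : ℤ) : D.evenGrading m s =
    Submodule.span ℤ {x | ∃ I l, mDeg I = m ∧ sDeg I l.length = s ∧ x = evenProd I l} := by
  apply le_antisymm
  · rw [evenGrading, Finsupp.supported_eq_span_single, Submodule.span_le]
    rintro _ ⟨⟨I, σ⟩, ⟨hm, hs⟩, rfl⟩
    obtain ⟨l, hl, rfl⟩ := exists_stateOf_eq σ
    refine Submodule.subset_span ⟨I, l, hm, ?_, ?_⟩
    · rw [← hs, sum_deg_stateOf hl, sDeg]
    · rw [evenProd, if_pos hl]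
  · rw [Submodule.span_le]
    rintro _ ⟨I, l, hm, hs, rfl⟩
    unfold evenProd
    split_ifs with hl
    · exact Finsupp.single_mem_supported ℤ _ ⟨hm, by rw [sum_deg_stateOf hl, ← hs, sDeg]⟩
    · exact Submodule.zero_mem _

/-- The product of the circles through the members of a list, in the odd complex. -/
def oddTerm (I : D.Vertex) (l : List D.Gen) : D.OddChain :=
  DirectSum.lof ℤ D.Vertex D.Lam I (oddProd I l)

lemma exteriorPower_le_span (I : D.Vertex) (r : ℕ) :
    ⋀[ℤ]^r (D.V I) ≤ Submodule.span ℤ {x | ∃ l : List D.Gen, l.length = r ∧ x = oddProd I l} := by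
  have h : LinearMap.range (ExteriorAlgebra.ι ℤ : D.V I →ₗ[ℤ] D.Lam I) =
      Submodule.span ℤ (Set.range fun x => circleι I (cir I x)) := by
    apply le_antisymm
    · rintro _ ⟨m, rfl⟩
      induction m using Finsupp.induction_linear with
      | zero => rw [map_zero]; exact Submodule.zero_mem _
      | add f g hf hg => rw [map_add]; exact Submodule.add_mem _ hf hg
      | single q r =>
        obtain ⟨x, rfl⟩ := cir_surjective I q
        have : (Finsupp.single (cir I x) r : D.V I) = r • Finsupp.single (cir I x) 1 := by simp
        rw [this, map_smul]
        exact Submodule.smul_mem _ _ (Submodule.subset_span ⟨x, rfl⟩)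
    · rw [Submodule.span_le]
      rintro _ ⟨x, rfl⟩
      exact ⟨_, rfl⟩
  rw [ExteriorAlgebra.exteriorPower, h, Submodule.span_pow]
  refine Submodule.span_mono fun x hx => ?_
  obtain ⟨f, rfl⟩ := Set.mem_pow.1 hx
  choose g hg using fun i => (f i).2
  refine ⟨List.ofFn g, by simp, ?_⟩
  rw [oddProd, List.map_ofFn]
  congr 2
  funext i
  exact (hg i).symm

lemma oddProd_mem (I : D.Vertex) (l : List D.Gen) : oddProd I l ∈ ⋀[ℤ]^l.length (D.V I) := by
  induction l with
  | nil => rw [List.length_nil, ExteriorAlgebra.exteriorPower, pow_zero]; exact Submodule.one_le.1 le_rfl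
  | cons x l ih =>
    rw [oddProd_cons, List.length_cons, ExteriorAlgebra.exteriorPower, pow_succ']
    exact Submodule.mul_mem_mul ⟨_, rfl⟩ ih

lemma oddGrading_eq_span (m s : ℤ) : D.oddGrading m s =
    Submodule.span ℤ {x | ∃ I l, mDeg I = m ∧ sDeg I l.length = s ∧ x = oddTerm I l} := by
  apply le_antisymm
  · unfold oddGrading
    refine iSup_le fun I => iSup_le fun r => iSup_le fun hm => iSup_le fun hs => ?_
    refine (Submodule.map_mono (exteriorPower_le_span I r)).trans ?_
    rw [Submodule.map_span, Submodule.span_le]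
    rintro _ ⟨_, ⟨l, rfl, rfl⟩, rfl⟩
    exact Submodule.subset_span ⟨I, l, hm, hs, rfl⟩
  · rw [Submodule.span_le]
    rintro _ ⟨I, l, hm, hs, rfl⟩
    unfold oddGrading
    refine Submodule.mem_iSup_of_mem I (Submodule.mem_iSup_of_mem l.length
      (Submodule.mem_iSup_of_mem hm (Submodule.mem_iSup_of_mem hs ?_)))
    exact ⟨_, oddProd_mem I l, rfl⟩

lemma evenDiff_map_le (m s : ℤ) :
    (D.evenGrading m s).map D.evenDiff ≤ D.evenGrading (m + 1) s := by
  rw [evenGrading_eq_span m s, Submodule.map_span, Submodule.span_le]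
  rintro _ ⟨_, ⟨I, l, hm, hs, rfl⟩, rfl⟩
  rw [evenDiff, LinearMap.sum_apply, SetLike.mem_coe]
  refine Submodule.sum_mem _ fun e _ => ?_
  rw [LinearMap.smul_apply]
  refine Submodule.smul_mem _ _ ?_
  by_cases hI : I = e.src
  · subst hI
    have hf := isFlip_edge e
    rw [evenGrading_eq_span]
    by_cases h : D.circ e.src (e.crossing, 0) = D.circ e.src (e.crossing, 2)
    · rw [(isHandleMap_evenMap e).split h, one_smul, one_smul]
      exact Submodule.add_mem _
        (Submodule.subset_span ⟨_, _, by rw [hf.mDeg, hm],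
          by rw [List.length_cons, hf.sDeg_of_eq h, hs], rfl⟩)
        (Submodule.subset_span ⟨_, _, by rw [hf.mDeg, hm],
          by rw [List.length_cons, hf.sDeg_of_eq h, hs], rfl⟩)
    · rw [(isHandleMap_evenMap e).merge h]
      exact Submodule.subset_span ⟨_, _, by rw [hf.mDeg, hm], by rw [hf.sDeg_of_ne h, hs], rfl⟩
  · rw [evenMap_evenProd_of_ne e hI]
    exact Submodule.zero_mem _

lemma oddEdge_oddTerm_of_ne (o : D.Arrows) (e : D.Edge) {I : D.Vertex} (hI : I ≠ e.src)
    (l : List D.Gen) : oddEdge o e (oddTerm I l) = 0 :=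
  oddEdge_lof_of_ne o e hI _

lemma oddEdge_oddTerm_merge (o : D.Arrows) (e : D.Edge)
    (h : D.circ e.src (e.crossing, 0) ≠ D.circ e.src (e.crossing, 2)) (l : List D.Gen) :
    oddEdge o e (oddTerm e.src l) = oddTerm e.tgt l := by
  rw [oddTerm, oddEdge_lof, (isHandleMap_oddMap o (isFlip_edge e)).merge h, oddTerm]

lemma oddEdge_oddTerm_split (o : D.Arrows) (e : D.Edge)
    (h : D.circ e.src (e.crossing, 0) = D.circ e.src (e.crossing, 2)) (l : List D.Gen) :
    oddEdge o e (oddTerm e.src l) = arrowSign o e.crossing •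
      (oddTerm e.tgt (.inl (e.crossing, 1) :: l) +
        (-1 : ℤ) • oddTerm e.tgt (.inl (e.crossing, 3) :: l)) := by
  rw [oddTerm, oddEdge_lof, (isHandleMap_oddMap o (isFlip_edge e)).split h, map_smul, map_add,
    map_smul]
  rfl

lemma oddDiff_map_le (o : D.Arrows) (ε : D.Edge → ℤˣ) (m s : ℤ) :
    (D.oddGrading m s).map (D.oddDiff o ε) ≤ D.oddGrading (m + 1) s := by
  rw [oddGrading_eq_span m s, Submodule.map_span, Submodule.span_le]
  rintro _ ⟨_, ⟨I, l, hm, hs, rfl⟩, rfl⟩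
  rw [oddDiff_eq, LinearMap.sum_apply, SetLike.mem_coe]
  refine Submodule.sum_mem _ fun e _ => ?_
  rw [LinearMap.smul_apply]
  refine Submodule.smul_mem _ _ ?_
  by_cases hI : I = e.src
  · subst hI
    have hf := isFlip_edge e
    rw [oddGrading_eq_span]
    by_cases h : D.circ e.src (e.crossing, 0) = D.circ e.src (e.crossing, 2)
    · rw [oddEdge_oddTerm_split o e h]
      exact Submodule.smul_mem _ _ (Submodule.add_mem _
        (Submodule.subset_span ⟨_, _, by rw [hf.mDeg, hm],
          by rw [List.length_cons, hf.sDeg_of_eq h, hs], rfl⟩)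
        (Submodule.smul_mem _ _ (Submodule.subset_span ⟨_, _, by rw [hf.mDeg, hm],
          by rw [List.length_cons, hf.sDeg_of_eq h, hs], rfl⟩)))
    · rw [oddEdge_oddTerm_merge o e h]
      exact Submodule.subset_span ⟨_, _, by rw [hf.mDeg, hm], by rw [hf.sDeg_of_ne h, hs], rfl⟩
  · rw [oddEdge_oddTerm_of_ne o e hI]
    exact Submodule.zero_mem _

/-- The fibres of `f` partition the basis. It is applied to the bidegree of enhanced states. -/
lemma isInternal_supported {α ι : Type*} [DecidableEq ι] (f : α → ι) :
    DirectSum.IsInternal fun i => Finsupp.supported ℤ ℤ {a | f a = i} := by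
  apply DirectSum.isInternal_submodule_of_iSupIndep_of_iSup_eq_top
  · intro i
    refine Disjoint.mono_right (c := Finsupp.supported ℤ ℤ {a | f a ≠ i}) ?_ ?_
    · refine iSup₂_le fun j hj => Finsupp.supported_mono fun a ha => ?_
      rintro rfl
      exact hj ha.symm
    · exact Finsupp.disjoint_supported_supported (Set.disjoint_left.2 fun a ha ha' => ha' ha)
  · have hsup : ⨆ i, Finsupp.supported ℤ ℤ {a | f a = i} =
        Finsupp.supported ℤ ℤ (⋃ i, {a | f a = i}) := by
      simp only [Finsupp.supported_iUnion]
    rw [hsup, eq_top_iff, ← Finsupp.supported_univ]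
    exact Finsupp.supported_mono fun a _ => Set.mem_iUnion.2 ⟨f a, rfl⟩

lemma isBigradedComplex_even : IsBigradedComplex D.evenGrading D.evenDiff where
  internal := by
    have := isInternal_supported fun S : D.EnhancedState => ((D.height S.1 : ℤ) - D.nMinus,
      (∑ a, (S.2 a).deg) + D.nPlus - 2 * D.nMinus + D.height S.1)
    simp only [Prod.ext_iff] at this
    exact this
  map_le := evenDiff_map_le
  sq_zero := evenDiff_comp_self

end LinkDiagram
end OddKhovanov
end

noncomputable section
namespace OddKhovanov

/-! ### Reduction modulo two -/

/-- Reduction modulo two. -/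
abbrev modTwo (M : Type*) [AddCommGroup M] : M →ₗ[ℤ] M ⧸ LinearMap.range (LinearMap.lsmul ℤ M 2) :=
  Submodule.mkQ _

lemma modTwo_eq_zero_iff {M : Type*} [AddCommGroup M] {x : M} :
    modTwo M x = 0 ↔ ∃ y, x = (2 : ℤ) • y := by
  rw [Submodule.mkQ_apply, Submodule.Quotient.mk_eq_zero]
  exact ⟨fun ⟨y, hy⟩ => ⟨y, hy.symm⟩, fun ⟨y, hy⟩ => ⟨y, hy.symm⟩⟩

lemma modTwo_smul {M : Type*} [AddCommGroup M] {u : ℤ} (hu : Odd u) (x : M) :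
    modTwo M (u • x) = modTwo M x := by
  obtain ⟨k, rfl⟩ := hu
  rw [← sub_eq_zero, ← map_sub, modTwo_eq_zero_iff]
  exact ⟨k • x, by module⟩

/-- An isomorphism of bigraded groups that commutes with the differentials modulo two. -/
lemma modTwoIsomorphic_of_equiv {M N : Type} [AddCommGroup M] [AddCommGroup N]
    {grM : ℤ → ℤ → Submodule ℤ M} {dM : M →ₗ[ℤ] M} {grN : ℤ → ℤ → Submodule ℤ N}
    {dN : N →ₗ[ℤ] N} (f : M ≃ₗ[ℤ] N) (hd : ∀ x, modTwo N (f (dM x)) = modTwo N (dN (f x)))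
    (hgr : ∀ m s, (grM m s).map f.toLinearMap = grN m s) :
    ModTwoIsomorphic grM dM grN dN := by
  obtain ⟨Φ, hΦ⟩ : ∃ Φ : (M ⊗[ℤ] ZMod 2) ≃ₗ[ℤ] (N ⊗[ℤ] ZMod 2),
      ∀ x a, Φ (x ⊗ₜ a) = f x ⊗ₜ a :=
    ⟨(LinearEquiv.rTensor (ZMod 2) f).toAddEquiv.toIntLinearEquiv, fun _ _ => rfl⟩
  refine ⟨Φ, fun x => ?_, fun m s => ?_⟩
  · induction x using TensorProduct.induction_on with
    | zero => simp only [map_zero]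
    | add x y hx hy => simp only [map_add, hx, hy]
    | tmul x a =>
      rw [LinearMap.rTensor_tmul, hΦ, hΦ, LinearMap.rTensor_tmul, ← sub_eq_zero,
        ← TensorProduct.sub_tmul]
      have h := hd x
      rw [← sub_eq_zero, ← map_sub, modTwo_eq_zero_iff] at h
      obtain ⟨y, hy⟩ := h
      -- The discrepancy between the differentials is divisible by two; the factor 2 moves across
      -- the tensor product and kills ℤ/2.
      rw [hy, TensorProduct.smul_tmul]
      have : (2 : ℤ) • a = 0 := by revert a; decide
      rw [this, TensorProduct.tmul_zero]
  · apply le_antisymm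
    · have key (y : grM m s ⊗[ℤ] ZMod 2) :
          Φ (LinearMap.rTensor (ZMod 2) (grM m s).subtype y) ∈ modTwoGrading grN m s := by
        induction y using TensorProduct.induction_on with
        | zero => rw [map_zero, map_zero]; exact Submodule.zero_mem _
        | add x y hx hy => rw [map_add, map_add]; exact Submodule.add_mem _ hx hy
        | tmul x a =>
          have hx : f x.1 ∈ grN m s := hgr m s ▸ ⟨x.1, x.2, rfl⟩
          exact ⟨⟨f x.1, hx⟩ ⊗ₜ a, (hΦ x.1 a).symm⟩
      rintro _ ⟨_, ⟨y, rfl⟩, rfl⟩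
      exact key y
    · have key (y : grN m s ⊗[ℤ] ZMod 2) : LinearMap.rTensor (ZMod 2) (grN m s).subtype y ∈
          (modTwoGrading grM m s).map Φ.toLinearMap := by
        induction y using TensorProduct.induction_on with
        | zero => rw [map_zero]; exact Submodule.zero_mem _
        | add x y hx hy => rw [map_add]; exact Submodule.add_mem _ hx hy
        | tmul z a =>
          obtain ⟨x, hx, hxz⟩ : z.1 ∈ (grM m s).map f.toLinearMap := (hgr m s).symm ▸ z.2
          refine ⟨x ⊗ₜ a, ⟨⟨x, hx⟩ ⊗ₜ a, rfl⟩, (hΦ x a).trans ?_⟩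
          rw [LinearMap.rTensor_tmul, Submodule.subtype_apply, ← hxz]
          rfl
      rintro _ ⟨y, rfl⟩
      exact key y

namespace LinkDiagram

variable {D : LinkDiagram}

/-! ### The comparison of the two complexes -/

lemma prod_circleι_of_perm {I : D.Vertex} {L L' : List (D.Circle I)} (h : L.Perm L') :
    ∃ u : ℤˣ, (L.map (circleι I)).prod = (u : ℤ) • (L'.map (circleι I)).prod := by
  induction h with
  | nil => exact ⟨1, by simp⟩
  | cons q _ ih =>
    obtain ⟨u, hu⟩ := ih
    exact ⟨u, by rw [List.map_cons, List.prod_cons, hu, List.map_cons, List.prod_cons,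
      mul_smul_comm]⟩
  | swap p q L =>
    refine ⟨-1, ?_⟩
    simp only [List.map_cons, List.prod_cons, ← mul_assoc]
    have h : circleι I q * circleι I p = -(circleι I p * circleι I q) :=
      eq_neg_of_add_eq_zero_left (ExteriorAlgebra.ι_add_mul_swap _ _)
    rw [h]
    simp
  | trans _ _ ih₁ ih₂ =>
    obtain ⟨u, hu⟩ := ih₁
    obtain ⟨v, hv⟩ := ih₂
    exact ⟨u * v, by rw [hu, hv, smul_smul, Units.val_mul]⟩

lemma prod_circleι_of_not_nodup {I : D.Vertex} {L : List (D.Circle I)} (h : ¬ L.Nodup) :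
    (L.map (circleι I)).prod = 0 := by
  obtain ⟨q, hq⟩ := List.exists_duplicate_iff_not_nodup.2 h
  obtain ⟨L', hL'⟩ := (List.duplicate_iff_sublist.1 hq).exists_perm_append
  obtain ⟨u, hu⟩ := prod_circleι_of_perm hL'
  have h0 : circleι I q * circleι I q = 0 := ExteriorAlgebra.ι_sq_zero _
  rw [hu]
  simp [← mul_assoc, h0]

/-- A basis of `Λ^* V(D(I))` indexed by the states of `D(I)`: the product of the circles labelled
`v₋` in some order. -/
lemma exists_stateBasis (I : D.Vertex) : ∃ b : Module.Basis (D.State I) ℤ (D.Lam I),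
    ∀ σ, ∃ L : List (D.Circle I), L.Nodup ∧ (∀ q, q ∈ L ↔ σ q = .minus) ∧
      b σ = (L.map (circleι I)).prod := by
  classical
  -- The standard basis of an exterior algebra needs an order of the circles. An arbitrary one will
  -- do, as the products matter only up to sign.
  let _ : LinearOrder (D.Circle I) :=
    LinearOrder.lift' (Fintype.equivFin (D.Circle I)) (Equiv.injective _)
  let B : Module.Basis (D.Circle I) ℤ (D.V I) := Finsupp.basisSingleOne
  let E : Finset (D.Circle I) ≃ D.State I :=
    { toFun := fun s q => if q ∈ s then .minus else .plus
      invFun := fun σ => Finset.univ.filter fun q => σ q = .minus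
      left_inv := fun s => by ext q; simp
      right_inv := fun σ => by funext q; rw [Label_eq_iff]; simp }
  refine ⟨B.ExteriorAlgebra.reindex E, fun σ => ?_⟩
  let s : Finset (D.Circle I) := Finset.univ.filter fun q => σ q = .minus
  let t := (Set.powersetCard.prodEquiv.symm s).2
  refine ⟨List.ofFn (Set.powersetCard.ofFinEmbEquiv.symm t), ?_, fun q => ?_, ?_⟩
  · exact List.nodup_ofFn.2 (RelEmbedding.injective _)
  · rw [List.mem_ofFn', Set.powersetCard.mem_range_ofFinEmbEquiv_symm_iff_mem]
    change q ∈ s ↔ _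
    simp [s]
  · rw [Module.Basis.reindex_apply]
    change B.ExteriorAlgebra s = _
    refine (ExteriorAlgebra.basis_apply B s).trans ?_
    refine (ExteriorAlgebra.ιMulti_apply _).trans ?_
    rw [List.map_ofFn]
    congr 2

/-- The comparison isomorphism of Khovanov's complex with the odd complex, which sends a state to
the product of the circles labelled `v₋`. It commutes with the differentials modulo two. -/
def compare : D.EvenChain ≃ₗ[ℤ] D.OddChain :=
  (sigmaFinsuppLequivDFinsupp ℤ).trans
    (DFinsupp.mapRange.linearEquiv fun I => (exists_stateBasis I).choose.repr.symm)

lemma compare_single (I : D.Vertex) (σ : D.State I) :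
    compare (Finsupp.single (⟨I, σ⟩ : D.EnhancedState) 1) =
      DirectSum.lof ℤ D.Vertex D.Lam I ((exists_stateBasis I).choose σ) := by
  classical
  unfold compare
  rw [LinearEquiv.trans_apply]
  have : (sigmaFinsuppLequivDFinsupp ℤ) (Finsupp.single (⟨I, σ⟩ : D.EnhancedState) (1 : ℤ)) =
      DFinsupp.single I (Finsupp.single σ 1) := sigmaFinsuppEquivDFinsupp_single _ _
  rw [this, DFinsupp.mapRange.linearEquiv_apply, DFinsupp.mapRange_single]
  simp
  rfl

/-- The comparison respects products of circles up to sign. -/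
lemma exists_compare_evenProd (I : D.Vertex) (l : List D.Gen) :
    ∃ u : ℤˣ, compare (evenProd I l) = (u : ℤ) • oddTerm I l := by
  unfold evenProd
  split_ifs with hl
  · obtain ⟨L, hL, hmem, hb⟩ := (exists_stateBasis I).choose_spec (stateOf I l)
    have hp : L.Perm (l.map (cir I)) := (List.perm_ext_iff_of_nodup hL hl).2 fun q => by
      rw [hmem, stateOf_eq_minus]
    obtain ⟨u, hu⟩ := prod_circleι_of_perm hp
    refine ⟨u, ?_⟩
    rw [compare_single, hb, hu, map_smul, List.map_map]
    rfl
  · refine ⟨1, ?_⟩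
    have : oddProd I l = 0 := by
      have := prod_circleι_of_not_nodup hl
      rwa [List.map_map] at this
    rw [oddTerm, this, map_zero, map_zero, smul_zero]

lemma map_compare_evenGrading (m s : ℤ) :
    (D.evenGrading m s).map (compare : D.EvenChain ≃ₗ[ℤ] D.OddChain).toLinearMap =
      D.oddGrading m s := by
  rw [evenGrading_eq_span, oddGrading_eq_span, Submodule.map_span]
  apply le_antisymm
  · rw [Submodule.span_le]
    rintro _ ⟨_, ⟨I, l, hm, hs, rfl⟩, rfl⟩
    obtain ⟨u, hu⟩ := exists_compare_evenProd I l
    rw [LinearEquiv.coe_coe, hu]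
    exact Submodule.smul_mem _ _ (Submodule.subset_span ⟨I, l, hm, hs, rfl⟩)
  · rw [Submodule.span_le]
    rintro _ ⟨I, l, hm, hs, rfl⟩
    obtain ⟨u, hu⟩ := exists_compare_evenProd I l
    have : oddTerm I l = (u : ℤ) • compare (evenProd I l) := by
      rw [hu, smul_smul, ← Units.val_mul, ← sq, Int.units_sq, Units.val_one, one_smul]
    rw [this]
    exact Submodule.smul_mem _ _ (Submodule.subset_span ⟨_, ⟨I, l, hm, hs, rfl⟩, rfl⟩)

lemma isInternal_map {ι M N : Type*} [DecidableEq ι] [AddCommGroup M] [AddCommGroup N]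
    {A : ι → Submodule ℤ M} (h : DirectSum.IsInternal A) (f : M ≃ₗ[ℤ] N) :
    DirectSum.IsInternal fun i => (A i).map f.toLinearMap := by
  rw [DirectSum.isInternal_submodule_iff_iSupIndep_and_iSup_eq_top] at h ⊢
  refine ⟨f.toLinearMap.iSupIndep_map f.injective h.1, ?_⟩
  rw [← Submodule.map_iSup, h.2, Submodule.map_top, LinearEquiv.range]

lemma isBigradedComplex_odd (o : D.Arrows) (ε : D.Edge → ℤˣ)
    (hε : D.IsTypeXAssignment o ε ∨ D.IsTypeYAssignment o ε) :
    IsBigradedComplex D.oddGrading (D.oddDiff o ε) where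
  internal := by
    -- Directness of the odd bigrading is transported from the even side, where it is a partition of
    -- a basis.
    have := isInternal_map D.isBigradedComplex_even.internal compare
    simp only [map_compare_evenGrading] at this
    exact this
  map_le := oddDiff_map_le o ε
  sq_zero := oddDiff_comp_self o ε hε

lemma odd_units (u : ℤˣ) : Odd (u : ℤ) := by
  rcases Int.units_eq_one_or u with rfl | rfl <;> decide

lemma odd_evenSign (e : D.Edge) : Odd (D.evenSign e) := Odd.pow (by decide)

lemma odd_arrowSign (o : D.Arrows) (c : Fin D.n) : Odd (arrowSign o c) := by
  unfold arrowSign; split_ifs <;> decide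

lemma modTwo_compare_evenProd (I : D.Vertex) (l : List D.Gen) :
    modTwo D.OddChain (compare (evenProd I l)) = modTwo D.OddChain (oddTerm I l) := by
  obtain ⟨u, hu⟩ := exists_compare_evenProd I l
  rw [hu, modTwo_smul (odd_units u)]

/-- Edge by edge, both sides send a product of circles to the same products with odd coefficients:
Khovanov's signs, `ε`, the arrow signs, the reordering signs and the minus sign in a₁ - a₂ are all 1
modulo two. -/
lemma modTwo_compare_evenDiff (o : D.Arrows) (ε : D.Edge → ℤˣ) (x : D.EvenChain) :
    modTwo D.OddChain (compare (D.evenDiff x)) =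
      modTwo D.OddChain (D.oddDiff o ε (compare x)) := by
  suffices h : modTwo D.OddChain ∘ₗ compare.toLinearMap ∘ₗ D.evenDiff =
      modTwo D.OddChain ∘ₗ D.oddDiff o ε ∘ₗ compare.toLinearMap from LinearMap.congr_fun h x
  refine evenChain_hom_ext fun I l => ?_
  obtain ⟨u, hu⟩ := exists_compare_evenProd I l
  simp only [LinearMap.comp_apply, LinearEquiv.coe_coe, hu]
  rw [map_smul, modTwo_smul (odd_units u), evenDiff, oddDiff_eq, LinearMap.sum_apply,
    LinearMap.sum_apply, map_sum, map_sum, map_sum]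
  refine Finset.sum_congr rfl fun e _ => ?_
  rw [LinearMap.smul_apply, LinearMap.smul_apply, map_smul, modTwo_smul (odd_evenSign e),
    modTwo_smul (odd_units _)]
  by_cases hI : I = e.src
  · subst hI
    by_cases h : D.circ e.src (e.crossing, 0) = D.circ e.src (e.crossing, 2)
    · rw [(isHandleMap_evenMap e).split h, oddEdge_oddTerm_split o e h, one_smul, one_smul,
        modTwo_smul (odd_arrowSign _ _), map_add, map_add, map_add, modTwo_smul (by decide),
        modTwo_compare_evenProd, modTwo_compare_evenProd]
    · rw [(isHandleMap_evenMap e).merge h, oddEdge_oddTerm_merge o e h, modTwo_compare_evenProd]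
  · rw [evenMap_evenProd_of_ne e hI, oddEdge_oddTerm_of_ne o e hI, map_zero]

lemma modTwoIsomorphic (o : D.Arrows) (ε : D.Edge → ℤˣ) :
    ModTwoIsomorphic D.evenGrading D.evenDiff D.oddGrading (D.oddDiff o ε) :=
  modTwoIsomorphic_of_equiv compare (modTwo_compare_evenDiff o ε) map_compare_evenGrading

lemma evenChain_eq_zero_of_two_smul (x : D.EvenChain) (h : (2 : ℤ) • x = 0) : x = 0 :=
  (smul_eq_zero.1 h).resolve_left two_ne_zero

lemma oddChain_eq_zero_of_two_smul (x : D.OddChain) (h : (2 : ℤ) • x = 0) : x = 0 := by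
  have : compare.symm x = 0 :=
    evenChain_eq_zero_of_two_smul _ (by rw [← map_smul, h, map_zero])
  simpa using this

end LinkDiagram
end OddKhovanov
end

noncomputable section
namespace OddKhovanov

open CategoryTheory

/-! ### The torsion product with `ℤ/2` -/

/-- The modules of the free resolution `ℤ → ℤ` of `ℤ/2`. -/
def resTwoX : ℕ → ModuleCat.{0} ℤ
  | 0 => ModuleCat.of ℤ ℤ
  | 1 => ModuleCat.of ℤ ℤ
  | _ + 2 => ModuleCat.of ℤ PUnit

/-- The differentials of the free resolution `ℤ → ℤ` of `ℤ/2`. -/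
def resTwoD : ∀ n, resTwoX (n + 1) ⟶ resTwoX n
  | 0 => ModuleCat.ofHom (LinearMap.lsmul ℤ ℤ 2)
  | _ + 1 => 0

lemma resTwoD_comp (n : ℕ) : resTwoD (n + 1) ≫ resTwoD n = 0 := Limits.zero_comp

/-- Multiplication by two on `ℤ`, as a chain complex. -/
def resTwoComplex : ChainComplex (ModuleCat.{0} ℤ) ℕ :=
  ChainComplex.of resTwoX resTwoD resTwoD_comp

lemma isZero_resTwoX (n : ℕ) : Limits.IsZero (resTwoX (n + 2)) :=
  ModuleCat.isZero_of_subsingleton (ModuleCat.of ℤ PUnit)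

lemma resTwoComplex_d (n : ℕ) : resTwoComplex.d (n + 1) n = resTwoD n :=
  ChainComplex.of_d _ _ _

instance (n : ℕ) : Projective (resTwoComplex.X n) := by
  have h : Projective (ModuleCat.of ℤ ℤ) := ModuleCat.projective_of_free (Module.Basis.singleton Unit ℤ)
  match n with
  | 0 => exact h
  | 1 => exact h
  | n + 2 => exact (isZero_resTwoX n).projective

/-- The projection of `ℤ` to `ℤ/2`. -/
def resTwoπ : resTwoX 0 ⟶ ModuleCat.of ℤ (ZMod 2) :=
  ModuleCat.ofHom (Algebra.linearMap ℤ (ZMod 2))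

lemma resTwoD_comp_π : resTwoD 0 ≫ resTwoπ = 0 := by
  ext
  rfl

lemma resTwo_exact : (ShortComplex.mk _ _ resTwoD_comp_π).Exact := by
  rw [ShortComplex.moduleCat_exact_iff]
  intro x hx
  obtain ⟨k, hk⟩ := (ZMod.intCast_zmod_eq_zero_iff_dvd x 2).1 hx
  exact ⟨k, hk.symm⟩

lemma resTwo_exactAt_succ (n : ℕ) : resTwoComplex.ExactAt (n + 1) := by
  rw [HomologicalComplex.exactAt_iff' _ (n + 2) (n + 1) n (by simp) (by simp)]
  match n with
  | 0 =>
    rw [ShortComplex.moduleCat_exact_iff]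
    intro x hx
    have hx' : resTwoD 0 x = 0 := by
      rw [← resTwoComplex_d]
      exact hx
    have key (k : ℤ) (hk : 2 * k = 0) : k = 0 := by omega
    have hx₀ : x = (0 : ℤ) := key x hx'
    exact ⟨0, by rw [map_zero]; exact hx₀.symm⟩
  | n + 1 => exact ShortComplex.exact_of_isZero_X₂ _ (isZero_resTwoX n)

/-- The free resolution `ℤ → ℤ` of `ℤ/2`. -/
def resTwo : ProjectiveResolution (ModuleCat.of ℤ (ZMod 2)) where
  complex := resTwoComplex
  π := (ChainComplex.toSingle₀Equiv _ _).symm ⟨resTwoπ, by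
    rw [resTwoComplex_d]; exact resTwoD_comp_π⟩
  quasiIso := ⟨fun n => by
    cases n
    · rw [ChainComplex.quasiIsoAt₀_iff, ShortComplex.quasiIso_iff_of_zeros']
      · refine (ShortComplex.exact_and_epi_g_iff_of_iso ?_).2 ⟨resTwo_exact, ?_⟩
        · exact ShortComplex.isoMk (Iso.refl _) (Iso.refl _) (Iso.refl _)
            (by
              refine (Category.id_comp _).trans (Eq.trans ?_ (Category.comp_id _).symm)
              exact (resTwoComplex_d 0).symm) (by
              refine (Category.id_comp _).trans (Eq.trans ?_ (Category.comp_id _).symm)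
              exact (ChainComplex.toSingle₀Equiv_symm_apply_f_zero (C := resTwoComplex)
                resTwoπ _).symm)
        · rw [ModuleCat.epi_iff_surjective]
          have hs : Function.Surjective (Int.cast : ℤ → ZMod 2) := ZMod.intCast_surjective
          exact hs
      all_goals rfl
    · rw [quasiIsoAt_iff_exactAt']
      · apply resTwo_exactAt_succ
      · apply ChainComplex.exactAt_succ_single_obj⟩


/-- The resolution has nothing in degree 2, so after tensoring with `A` the homology in degree 1 is
the kernel of the map induced by multiplication by two. -/
lemma torTwo_iso_aux (A : Type) [AddCommGroup A] :
    Nonempty (TorTwo A ≃ₗ[ℤ] LinearMap.ker (LinearMap.lTensor A (LinearMap.lsmul ℤ ℤ 2))) := by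
  let F := (MonoidalCategory.tensoringLeft (ModuleCat.{0} ℤ)).obj (ModuleCat.of ℤ A)
  let K := (F.mapHomologicalComplex (ComplexShape.down ℕ)).obj resTwoComplex
  let S := K.sc' 2 1 0
  have hf : S.f = 0 := (F.map_isZero (isZero_resTwoX 0)).eq_of_src _ _
  have hg : S.g = F.map (resTwoD 0) := by
    rw [← resTwoComplex_d]; rfl
  have e : TorTwo A ≅ ModuleCat.of ℤ (LinearMap.ker S.g.hom) :=
    resTwo.isoLeftDerivedObj F 1 ≪≫ K.homologyIsoSc' 2 1 0 (by simp) (by simp) ≪≫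
      (S.asIsoHomologyπ hf).symm ≪≫ S.moduleCatCyclesIso
  rw [hg] at e
  exact ⟨e.toLinearEquiv⟩

/-- The torsion product with `ℤ/2` is the 2-torsion subgroup. -/
lemma nonempty_torTwo_equiv (A : Type) [AddCommGroup A] :
    Nonempty (TorTwo A ≃ₗ[ℤ] LinearMap.ker (LinearMap.lsmul ℤ A 2)) := by
  obtain ⟨e⟩ := torTwo_iso_aux A
  let r : A ⊗[ℤ] ℤ ≃ₗ[ℤ] A := TensorProduct.rid ℤ A
  have hr (x : A ⊗[ℤ] ℤ) : r (LinearMap.lTensor A (LinearMap.lsmul ℤ ℤ 2) x) = (2 : ℤ) • r x := by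
    have hrt (a : A) (k : ℤ) : r (a ⊗ₜ k) = k • a := TensorProduct.rid_tmul _ _
    induction x using TensorProduct.induction_on with
    | zero => rw [map_zero, map_zero, smul_zero]
    | add x y hx hy => rw [map_add, map_add, hx, hy, map_add, smul_add]
    | tmul a k =>
      rw [LinearMap.lTensor_tmul, hrt, hrt, LinearMap.lsmul_apply, smul_assoc]
  have hr' (x : A ⊗[ℤ] ℤ) : LinearMap.lTensor A (LinearMap.lsmul ℤ ℤ 2) x = 0 ↔
      (2 : ℤ) • r x = 0 := by
    rw [← hr, r.map_eq_zero_iff]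
  let f : LinearMap.ker (LinearMap.lTensor A (LinearMap.lsmul ℤ ℤ 2)) ≃ₗ[ℤ]
      LinearMap.ker (LinearMap.lsmul ℤ A 2) :=
    { toFun := fun x => ⟨r x.1, (hr' x.1).1 x.2⟩
      invFun := fun a => ⟨r.symm a.1, (hr' _).2 (by rw [r.apply_symm_apply]; exact a.2)⟩
      left_inv := fun x => Subtype.ext (r.symm_apply_apply _)
      right_inv := fun a => Subtype.ext (r.apply_symm_apply _)
      map_add' := fun x y => Subtype.ext (r.map_add _ _)
      map_smul' := fun k x => Subtype.ext (r.map_smul _ _) }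
  exact ⟨e.trans f⟩

/-! ### The universal coefficient theorem modulo two -/

lemma exists_eq_tmul_one {A : Type*} [AddCommGroup A] (t : A ⊗[ℤ] ZMod 2) :
    ∃ a, t = a ⊗ₜ[ℤ] (1 : ZMod 2) := by
  induction t using TensorProduct.induction_on with
  | zero => exact ⟨0, by rw [TensorProduct.zero_tmul]⟩
  | add x y hx hy =>
    obtain ⟨a, rfl⟩ := hx
    obtain ⟨b, rfl⟩ := hy
    exact ⟨a + b, by rw [TensorProduct.add_tmul]⟩
  | tmul a k =>
    obtain ⟨n, rfl⟩ := ZMod.intCast_surjective k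
    refine ⟨n • a, ?_⟩
    rw [TensorProduct.smul_tmul, zsmul_one]

/-- A short exact sequence with a group that is killed by two in the middle splits. -/
lemma nonempty_equiv_prod_of_exact {A Q K : Type*} [AddCommGroup A] [AddCommGroup Q]
    [AddCommGroup K] (α : A →ₗ[ℤ] Q) (β : Q →ₗ[ℤ] K) (hβ : Function.Surjective β)
    (hαβ : ∀ q, β q = 0 ↔ ∃ a, α a = q) (hα : ∀ a, α a = 0 ↔ ∃ b, a = (2 : ℤ) • b)
    (hQ : ∀ q : Q, (2 : ℤ) • q = 0) : Nonempty (Q ≃ₗ[ℤ] K × (A ⊗[ℤ] ZMod 2)) := by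
  have hQ' (q : Q) : 2 • q = 0 := by rw [← hQ q, ← natCast_zsmul]; rfl
  have hK' (k : K) : 2 • k = 0 := by
    obtain ⟨q, rfl⟩ := hβ k
    rw [← map_nsmul, hQ', map_zero]
  -- Over the field ℤ/2 the surjection β has a section γ, which splits the sequence.
  let _ : Module (ZMod 2) Q := AddCommGroup.zmodModule hQ'
  let _ : Module (ZMod 2) K := AddCommGroup.zmodModule hK'
  obtain ⟨γ, hγ⟩ := (β.toAddMonoidHom.toZModLinearMap 2).exists_rightInverse_of_surjective
    (LinearMap.range_eq_top.2 hβ)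
  have hγ' (k : K) : β (γ k) = k := LinearMap.congr_fun hγ k
  obtain ⟨φ, hφ⟩ : ∃ φ : (A ⊗[ℤ] ZMod 2) →+ Q, ∀ a, φ (a ⊗ₜ 1) = α a :=
    ⟨(TensorProduct.lift (LinearMap.mk₂ ℤ (fun (a : A) (k : ZMod 2) => k • α a)
      (fun a b k => by rw [map_add, smul_add]) (fun n a k => by rw [map_smul, smul_comm])
      (fun a k l => add_smul _ _ _) (fun n a k => smul_assoc _ _ _))).toAddMonoidHom,
      fun a => by
        refine Eq.trans ?_ (one_smul (ZMod 2) (α a))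
        rw [LinearMap.toAddMonoidHom_coe, TensorProduct.lift.tmul, LinearMap.mk₂_apply]⟩
  let Θ : K × (A ⊗[ℤ] ZMod 2) →+ Q := AddMonoidHom.coprod γ.toAddMonoidHom φ
  have hΘ (k : K) (a : A) : Θ (k, a ⊗ₜ 1) = γ k + α a := by
    rw [← hφ]; rfl
  have hβα (a : A) : β (α a) = 0 := (hαβ _).2 ⟨a, rfl⟩
  have hbij : Function.Bijective Θ := by
    constructor
    · rw [injective_iff_map_eq_zero]
      rintro ⟨k, t⟩ h
      obtain ⟨a, rfl⟩ := exists_eq_tmul_one t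
      rw [hΘ] at h
      have hk : k = 0 := by
        have := congrArg β h
        rwa [map_add, hγ', hβα, add_zero, map_zero] at this
      subst hk
      rw [map_zero, zero_add, hα] at h
      obtain ⟨b, rfl⟩ := h
      have h2 : (2 : ℤ) • (1 : ZMod 2) = 0 := by decide
      rw [TensorProduct.smul_tmul, h2, TensorProduct.tmul_zero]
      rfl
    · intro q
      obtain ⟨a, ha⟩ := (hαβ (q - γ (β q))).1 (by rw [map_sub, hγ', sub_self])
      exact ⟨(β q, a ⊗ₜ 1), by rw [hΘ, ha, add_sub_cancel]⟩
  exact ⟨(AddEquiv.ofBijective Θ hbij).symm.toIntLinearEquiv⟩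

/-! ### Homology modulo two, described inside the integral complex -/

section Coefficients

variable {M : Type} [AddCommGroup M]

/-- The elements of `G` that become cycles modulo two. -/
def redCycles (G : Submodule ℤ M) (d : M →ₗ[ℤ] M) : Submodule ℤ M :=
  G ⊓ (LinearMap.range (LinearMap.lsmul ℤ M 2)).comap d

/-- The elements of `G` that become boundaries of elements of `G₀` modulo two. -/
def redBoundaries (G₀ G : Submodule ℤ M) (d : M →ₗ[ℤ] M) : Submodule ℤ M :=
  G ⊓ (G₀.map d ⊔ LinearMap.range (LinearMap.lsmul ℤ M 2))

/-- The homology modulo two. -/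
abbrev RedHomology (G₀ G : Submodule ℤ M) (d : M →ₗ[ℤ] M) : Type :=
  redCycles G d ⧸ (redBoundaries G₀ G d).submoduleOf (redCycles G d)

lemma mem_redBoundaries {G₀ G : Submodule ℤ M} {d : M →ₗ[ℤ] M} {x : M} :
    x ∈ redBoundaries G₀ G d ↔ x ∈ G ∧ ∃ z ∈ G₀, ∃ y, d z + (2 : ℤ) • y = x := by
  unfold redBoundaries
  rw [Submodule.mem_inf, Submodule.mem_sup]
  refine and_congr_right fun _ => ⟨?_, ?_⟩
  · rintro ⟨_, ⟨z, hz, rfl⟩, _, ⟨y, rfl⟩, rfl⟩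
    exact ⟨z, hz, y, rfl⟩
  · rintro ⟨z, hz, y, rfl⟩
    exact ⟨_, ⟨z, hz, rfl⟩, _, ⟨y, rfl⟩, rfl⟩

/-- The universal coefficient theorem for coefficients `ℤ/2`, for three consecutive groups of a
complex without 2-torsion. -/
lemma nonempty_redHomology_equiv {G₀ G₁ G₂ : Submodule ℤ M} {d : M →ₗ[ℤ] M}
    (hd : ∀ x, d (d x) = 0) (h₀ : ∀ x ∈ G₀, d x ∈ G₁) (h₁ : ∀ x ∈ G₁, d x ∈ G₂)
    (htf : ∀ x : M, (2 : ℤ) • x = 0 → x = 0) (hs₁ : ∀ x, (2 : ℤ) • x ∈ G₁ → x ∈ G₁)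
    (hs₂ : ∀ x, (2 : ℤ) • x ∈ G₂ → x ∈ G₂) :
    Nonempty (RedHomology G₀ G₁ d ≃ₗ[ℤ]
      LinearMap.ker (LinearMap.lsmul ℤ (↥(G₂ ⊓ LinearMap.ker d) ⧸
        (G₁.map d).submoduleOf (G₂ ⊓ LinearMap.ker d)) 2) ×
      ((↥(G₁ ⊓ LinearMap.ker d) ⧸ (G₀.map d).submoduleOf (G₁ ⊓ LinearMap.ker d)) ⊗[ℤ]
        ZMod 2)) := by
  let C₁ := G₁ ⊓ LinearMap.ker d
  let C₂ := G₂ ⊓ LinearMap.ker d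
  have hinj : Function.Injective (LinearMap.lsmul ℤ M 2) :=
    (injective_iff_map_eq_zero _).2 fun x hx => htf x hx
  have hcan {x y : M} (h : (2 : ℤ) • x = (2 : ℤ) • y) : x = y := hinj h
  -- half of the differential
  obtain ⟨η, hη⟩ : ∃ η : redCycles G₁ d →ₗ[ℤ] M, ∀ x, (2 : ℤ) • η x = d x.1 := by
    let e := LinearEquiv.ofInjective (LinearMap.lsmul ℤ M 2) hinj
    refine ⟨e.symm.toLinearMap ∘ₗ (d ∘ₗ (redCycles G₁ d).subtype).codRestrict _
      (fun x => x.2.2), fun x => ?_⟩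
    exact congrArg Subtype.val (e.apply_symm_apply ⟨d x.1, x.2.2⟩)
  have hηC (x) : η x ∈ C₂ := by
    refine ⟨hs₂ _ (by rw [hη]; exact h₁ _ x.2.1), ?_⟩
    refine htf _ ?_
    rw [← map_smul, hη, hd]
  -- The Bockstein map: a cycle modulo two `x` goes to the class of `d x / 2`, which is killed by
  -- two because its double is the boundary of `x`.
  let β₀ : redCycles G₁ d →ₗ[ℤ] (C₂ ⧸ (G₁.map d).submoduleOf C₂) :=
    Submodule.mkQ _ ∘ₗ η.codRestrict C₂ hηC
  have hβ₀ (x) : β₀ x = 0 ↔ ∃ w ∈ G₁, d w = η x :=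
    Submodule.Quotient.mk_eq_zero _
  have hβ₀' (x) : (2 : ℤ) • β₀ x = 0 := by
    rw [← map_smul, hβ₀]
    exact ⟨x.1, x.2.1, by rw [map_smul, hη]⟩
  let β₁ : redCycles G₁ d →ₗ[ℤ] LinearMap.ker (LinearMap.lsmul ℤ
      (C₂ ⧸ (G₁.map d).submoduleOf C₂) 2) := β₀.codRestrict _ hβ₀'
  have hβ₁ (x) : β₁ x = 0 ↔ ∃ w ∈ G₁, d w = η x := by
    rw [← hβ₀, Subtype.ext_iff]; rfl
  let β : RedHomology G₀ G₁ d →ₗ[ℤ] _ := Submodule.liftQ _ β₁ (by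
    intro x hx
    obtain ⟨-, z, hz, y, hy⟩ := mem_redBoundaries.1 hx
    rw [LinearMap.mem_ker, hβ₁]
    refine ⟨y, hs₁ _ ?_, hcan ?_⟩
    · rw [eq_sub_of_add_eq' hy]
      exact Submodule.sub_mem _ x.2.1 (h₀ z hz)
    · rw [hη, Submodule.subtype_apply] at *
      rw [← hy, map_add, hd, zero_add, map_smul])
  have hle : C₁ ≤ redCycles G₁ d := fun x hx =>
    ⟨hx.1, ⟨0, by rw [map_zero]; exact hx.2.symm⟩⟩
  let α₀ : C₁ →ₗ[ℤ] RedHomology G₀ G₁ d := Submodule.mkQ _ ∘ₗ Submodule.inclusion hle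
  have hα₀ (x) : α₀ x = 0 ↔ x.1 ∈ redBoundaries G₀ G₁ d := Submodule.Quotient.mk_eq_zero _
  let α : (C₁ ⧸ (G₀.map d).submoduleOf C₁) →ₗ[ℤ] RedHomology G₀ G₁ d :=
    Submodule.liftQ _ α₀ (by
      rintro x ⟨z, hz, hzx⟩
      rw [LinearMap.mem_ker, hα₀, mem_redBoundaries]
      exact ⟨x.2.1, z, hz, 0, by rw [smul_zero, add_zero]; exact hzx⟩)
  refine nonempty_equiv_prod_of_exact α β ?_ ?_ ?_ ?_
  · rintro ⟨k, hk⟩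
    obtain ⟨y, rfl⟩ := Submodule.mkQ_surjective _ k
    have hk' : (2 : ℤ) • (Submodule.mkQ ((G₁.map d).submoduleOf C₂)) y = 0 := hk
    rw [← map_smul, Submodule.mkQ_apply, Submodule.Quotient.mk_eq_zero] at hk'
    obtain ⟨x, hx, hxy⟩ := hk'
    have hxy' : d x = (2 : ℤ) • y.1 := hxy
    refine ⟨Submodule.mkQ _ ⟨x, hx, y.1, hxy'.symm⟩, Subtype.ext ?_⟩
    change Submodule.mkQ _ _ = _
    congr 1
    refine Subtype.ext (hcan ?_)
    exact (hη _).trans hxy'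
  · intro q
    obtain ⟨x, rfl⟩ := Submodule.mkQ_surjective _ q
    change β₁ x = 0 ↔ _
    rw [hβ₁]
    constructor
    · rintro ⟨w, hw, hwx⟩
      -- If half of `d x` is the boundary of `w`, then x - 2w is an integral cycle with the same
      -- reduction as `x`.
      have hx : x.1 - (2 : ℤ) • w ∈ C₁ := by
        refine ⟨Submodule.sub_mem _ x.2.1 (Submodule.smul_mem _ _ hw), ?_⟩
        change d (x.1 - (2 : ℤ) • w) = 0
        rw [map_sub, map_smul, hwx, hη, sub_self]
      refine ⟨Submodule.mkQ _ ⟨_, hx⟩, ?_⟩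
      refine (Submodule.Quotient.eq _).2 (mem_redBoundaries.2 ?_)
      refine ⟨Submodule.sub_mem _ hx.1 x.2.1, 0, Submodule.zero_mem _, -w, ?_⟩
      change _ = x.1 - (2 : ℤ) • w - x.1
      rw [map_zero]
      module
    · rintro ⟨a, ha⟩
      obtain ⟨y, rfl⟩ := Submodule.mkQ_surjective _ a
      have hyx : y.1 - x.1 ∈ redBoundaries G₀ G₁ d :=
        (Submodule.Quotient.eq (x := Submodule.inclusion hle y) (y := x) _).1 ha
      obtain ⟨-, z, hz, w, hw⟩ := mem_redBoundaries.1 hyx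
      have hx : x.1 = y.1 - d z - (2 : ℤ) • w := by rw [sub_sub, hw, sub_sub_cancel]
      refine ⟨-w, hs₁ _ ?_, hcan ?_⟩
      · have : (2 : ℤ) • -w = x.1 - y.1 + d z := by rw [hx]; module
        rw [this]
        exact Submodule.add_mem _ (Submodule.sub_mem _ x.2.1 y.2.1) (h₀ z hz)
      · have hy : d y.1 = 0 := y.2.2
        rw [hη, hx, map_sub, map_sub, hd, hy, map_smul, map_neg]
        module
  · intro a
    obtain ⟨x, rfl⟩ := Submodule.mkQ_surjective _ a
    change α₀ x = 0 ↔ _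
    rw [hα₀, mem_redBoundaries]
    constructor
    · rintro ⟨-, z, hz, y, hy⟩
      have hx : d x.1 = 0 := x.2.2
      -- An integral cycle x = d z + 2y has d (2y) = 0, so `y` is itself a cycle and the class of
      -- `x` is twice that of `y`.
      have hyC : y ∈ C₁ := by
        refine ⟨hs₁ _ ?_, htf _ ?_⟩
        · rw [eq_sub_of_add_eq' hy]
          exact Submodule.sub_mem _ x.2.1 (h₀ z hz)
        · rw [← hy, map_add, hd, zero_add, map_smul] at hx
          exact hx
      refine ⟨Submodule.mkQ _ ⟨y, hyC⟩, ?_⟩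
      rw [← map_smul]
      refine (Submodule.Quotient.eq _).2 ⟨z, hz, ?_⟩
      change d z = x.1 - (2 : ℤ) • y
      rw [← hy, add_sub_cancel_right]
    · rintro ⟨b, hb⟩
      obtain ⟨y, rfl⟩ := Submodule.mkQ_surjective _ b
      rw [← map_smul] at hb
      obtain ⟨z, hz, hzx⟩ := (Submodule.Quotient.eq _).1 hb
      have hzx' : d z = x.1 - (2 : ℤ) • y.1 := hzx
      exact ⟨x.2.1, z, hz, y.1, by rw [hzx', sub_add_cancel]⟩
  · intro q
    obtain ⟨x, rfl⟩ := Submodule.mkQ_surjective _ q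
    rw [← map_smul]
    refine (Submodule.Quotient.mk_eq_zero _).2 (mem_redBoundaries.2 ?_)
    exact ⟨Submodule.smul_mem _ _ x.2.1, 0, Submodule.zero_mem _, x.1, by
      rw [map_zero, zero_add]; rfl⟩

end Coefficients

end OddKhovanov
end

noncomputable section
namespace OddKhovanov

/-! ### Comparison of the homology groups -/

section Comparison

variable {M N : Type} [AddCommGroup M] [AddCommGroup N]

lemma modTwo_eq_iff {x y : M} : modTwo M x = modTwo M y ↔ ∃ z, x - y = (2 : ℤ) • z := by
  rw [← sub_eq_zero, ← map_sub, modTwo_eq_zero_iff]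

/-- An isomorphism that commutes with the differentials modulo two induces an isomorphism of the
homology modulo two. -/
lemma nonempty_redHomology_congr {G₀ G : Submodule ℤ M} {H₀ H : Submodule ℤ N}
    {d : M →ₗ[ℤ] M} {d' : N →ₗ[ℤ] N} (f : M ≃ₗ[ℤ] N) (h₀ : G₀.map f.toLinearMap = H₀)
    (h : G.map f.toLinearMap = H) (hd : ∀ x, modTwo N (f (d x)) = modTwo N (d' (f x))) :
    Nonempty (RedHomology G₀ G d ≃ₗ[ℤ] RedHomology H₀ H d') := by
  subst h₀ h
  have hmem {G : Submodule ℤ M} {x : M} : f x ∈ G.map f.toLinearMap ↔ x ∈ G :=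
    ⟨fun ⟨_, hy, h⟩ => f.injective h ▸ hy, fun h => ⟨x, h, rfl⟩⟩
  -- The error term is written as an image under `f`, so that it can be absorbed into the multiples
  -- of two on either side.
  have hd' (x : M) : ∃ z, f (d x) = d' (f x) + (2 : ℤ) • f z := by
    obtain ⟨z, hz⟩ := modTwo_eq_iff.1 (hd x)
    exact ⟨f.symm z, by rw [f.apply_symm_apply, ← hz, add_sub_cancel]⟩
  have hc (x : M) : f x ∈ redCycles (G.map f.toLinearMap) d' ↔ x ∈ redCycles G d := by
    obtain ⟨z, hz⟩ := hd' x
    refine and_congr hmem ⟨?_, ?_⟩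
    · rintro ⟨y, hy⟩
      refine ⟨f.symm y + z, f.injective ?_⟩
      change (2 : ℤ) • y = _ at hy
      change f ((2 : ℤ) • (f.symm y + z)) = _
      rw [map_smul, map_add, f.apply_symm_apply, hz, smul_add, hy]
    · rintro ⟨y, hy⟩
      refine ⟨f (y - z), ?_⟩
      change (2 : ℤ) • y = _ at hy
      change (2 : ℤ) • f (y - z) = _
      rw [map_sub, smul_sub, ← map_smul, hy, hz, add_sub_cancel_right]
  have hb (x : M) : f x ∈ redBoundaries (G₀.map f.toLinearMap) (G.map f.toLinearMap) d' ↔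
      x ∈ redBoundaries G₀ G d := by
    rw [mem_redBoundaries, mem_redBoundaries, hmem]
    refine and_congr_right fun _ => ⟨?_, ?_⟩
    · rintro ⟨_, ⟨w, hw, rfl⟩, y, hy⟩
      obtain ⟨z, hz⟩ := hd' w
      refine ⟨w, hw, f.symm y - z, f.injective ?_⟩
      rw [map_add, map_smul, map_sub, f.apply_symm_apply, hz, smul_sub, ← hy]
      change _ = d' (f w) + _
      abel
    · rintro ⟨w, hw, y, hy⟩
      obtain ⟨z, hz⟩ := hd' w
      refine ⟨f w, hmem.2 hw, f (z + y), ?_⟩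
      rw [← hy, f.map_add (d w), f.map_add z, map_smul, hz, smul_add, add_assoc]
  have hC : (redCycles G d).map f.toLinearMap = redCycles (G.map f.toLinearMap) d' := by
    ext y
    obtain ⟨x, rfl⟩ := f.surjective y
    rw [hmem, hc]
  refine ⟨Submodule.Quotient.equiv _ _ (f.ofSubmodules _ _ hC) ?_⟩
  ext y
  obtain ⟨x, rfl⟩ := (f.ofSubmodules _ _ hC).surjective y
  refine Iff.trans ⟨?_, fun h => ⟨x, h, rfl⟩⟩ (hb x.1).symm
  rintro ⟨z, hz, h⟩
  exact (f.ofSubmodules _ _ hC).injective h ▸ hz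

/-- The components of 2x outside degree `i` vanish, and so do those of `x` in the absence of
2-torsion. This permits division by two within a bidegree. -/
lemma mem_of_two_smul_mem {ι : Type*} [DecidableEq ι] {G : ι → Submodule ℤ M} (hG : DirectSum.IsInternal G)
    (htf : ∀ x : M, (2 : ℤ) • x = 0 → x = 0) {i : ι} {x : M} (hx : (2 : ℤ) • x ∈ G i) :
    x ∈ G i := by
  classical
  let _ := hG.chooseDecomposition
  rw [← DirectSum.sum_support_decompose G x]
  refine Submodule.sum_mem _ fun j _ => ?_
  by_cases hij : i = j
  · subst hij
    exact (DirectSum.decompose G x i).2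
  · have h := DirectSum.decompose_of_mem_ne G hx hij
    rw [DirectSum.decompose_smul] at h
    rw [htf (DirectSum.decompose G x j : M) h]
    exact Submodule.zero_mem _

/-- The universal coefficient theorem for a bigraded complex without 2-torsion. -/
lemma IsBigradedComplex.nonempty_homology_equiv {gr : ℤ → ℤ → Submodule ℤ M} {d : M →ₗ[ℤ] M}
    (h : IsBigradedComplex gr d) (htf : ∀ x : M, (2 : ℤ) • x = 0 → x = 0) (m s : ℤ) :
    Nonempty ((TorTwo (Homology gr d (m + 1) s) × (Homology gr d m s ⊗[ℤ] ZMod 2)) ≃ₗ[ℤ]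
      RedHomology (gr (m - 1) s) (gr m s) d) := by
  have hmap {m s : ℤ} {x : M} (hx : x ∈ gr m s) : d x ∈ gr (m + 1) s :=
    h.map_le m s ⟨x, hx, rfl⟩
  have hmem (m s : ℤ) (x : M) (hx : (2 : ℤ) • x ∈ gr m s) : x ∈ gr m s :=
    mem_of_two_smul_mem h.internal htf (i := (m, s)) hx
  obtain ⟨e⟩ := nonempty_redHomology_equiv (G₀ := gr (m - 1) s) (G₁ := gr m s)
    (G₂ := gr (m + 1) s) (d := d) (LinearMap.congr_fun h.sq_zero)
    (fun x hx => by simpa only [sub_add_cancel] using hmap hx) (fun x hx => hmap hx) htf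
    (hmem _ _) (hmem _ _)
  obtain ⟨t⟩ := nonempty_torTwo_equiv (Homology gr d (m + 1) s)
  -- Boundaries in degree m + 1 are defined from degree (m + 1) - 1, which has to be rewritten as m.
  have hb : boundaries gr d (m + 1) s = (gr m s).map d := by
    rw [boundaries, add_sub_cancel_right]
  have t' : Nonempty (TorTwo (Homology gr d (m + 1) s) ≃ₗ[ℤ]
      LinearMap.ker (LinearMap.lsmul ℤ (↥(gr (m + 1) s ⊓ LinearMap.ker d) ⧸
        ((gr m s).map d).submoduleOf (gr (m + 1) s ⊓ LinearMap.ker d)) 2)) := by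
    rw [← hb]
    exact ⟨t⟩
  obtain ⟨t'⟩ := t'
  let p : TorTwo (Homology gr d (m + 1) s) × (Homology gr d m s ⊗[ℤ] ZMod 2) ≃+
      RedHomology (gr (m - 1) s) (gr m s) d :=
    (t'.toAddEquiv.prodCongr (AddEquiv.refl (Homology gr d m s ⊗[ℤ] ZMod 2))).trans
      e.symm.toAddEquiv
  exact ⟨p.toIntLinearEquiv⟩

end Comparison

namespace LinkDiagram

variable {D : LinkDiagram}

/-- The universal coefficient groups of the even and of the odd homology agree. -/
lemma nonempty_torTwo_prod_equiv (o : D.Arrows) (ε : D.Edge → ℤˣ)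
    (hε : D.IsTypeXAssignment o ε ∨ D.IsTypeYAssignment o ε) (m s : ℤ) :
    Nonempty ((TorTwo (D.EvenKh (m + 1) s) × (D.EvenKh m s ⊗[ℤ] ZMod 2)) ≃ₗ[ℤ]
      (TorTwo (D.OddKh o ε (m + 1) s) × (D.OddKh o ε m s ⊗[ℤ] ZMod 2))) := by
  obtain ⟨e⟩ := (isBigradedComplex_even (D := D)).nonempty_homology_equiv
    evenChain_eq_zero_of_two_smul m s
  obtain ⟨e'⟩ := (isBigradedComplex_odd o ε hε).nonempty_homology_equiv
    oddChain_eq_zero_of_two_smul m s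
  obtain ⟨r⟩ := nonempty_redHomology_congr (compare (D := D))
    (map_compare_evenGrading (m - 1) s) (map_compare_evenGrading m s)
    (modTwo_compare_evenDiff o ε)
  exact ⟨(e.trans r).trans e'.symm⟩

end LinkDiagram

end OddKhovanov
end

theorem proposition1p5 (D : OddKhovanov.LinkDiagram) (o : D.Arrows) (ε : D.Edge → ℤˣ)
    (hε : D.IsTypeXAssignment o ε ∨ D.IsTypeYAssignment o ε) :
    OddKhovanov.IsBigradedComplex D.evenGrading D.evenDiff ∧
    OddKhovanov.IsBigradedComplex D.oddGrading (D.oddDiff o ε) ∧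
    OddKhovanov.ModTwoIsomorphic D.evenGrading D.evenDiff D.oddGrading (D.oddDiff o ε) ∧
    ∀ m s : ℤ, Nonempty
      ((OddKhovanov.TorTwo (D.EvenKh (m + 1) s) × (D.EvenKh m s ⊗[ℤ] ZMod 2)) ≃ₗ[ℤ]
        (OddKhovanov.TorTwo (D.OddKh o ε (m + 1) s) × (D.OddKh o ε m s ⊗[ℤ] ZMod 2))) :=
  ⟨OddKhovanov.LinkDiagram.isBigradedComplex_even,
    OddKhovanov.LinkDiagram.isBigradedComplex_odd o ε hε,
    OddKhovanov.LinkDiagram.modTwoIsomorphic o ε,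
    OddKhovanov.LinkDiagram.nonempty_torTwo_prod_equiv o ε hε⟩
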